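/- Let $N\ge 1$ and let $J:\mathbb{R}^N\to[0,\infty)$ be radially symmetric, continuous and compactly supported, with $\int_{\mathbb{R}^N}J(z)\,dz=1$. For a measurable function $\mu:\mathbb{R}^N\to\mathbb{R}$ put \[ \mathcal{G}_\mu(x,s)=1+\frac{\mu(x)\,s}{2\,(1+\mu(x)^2s^2)},\qquad x\in\mathbb{R}^N,\ s\in\mathbb{R}. \] Let $0\le\mu\in L^\infty(\mathbb{R}^N)$ and let $0\le u_0\in L^1(\mathbb{R}^N)\cap L^\infty(\mathbb{R}^N)\cap \mathcal{C}(\mathbb{R}^N)$ satisfy \[ \|u_0\|_{L^\infty(\mathbb{R}^N)}\,\|\mu\|_{L^\infty(\mathbb{R}^N)}<1 . \] Let $u\in \mathcal{C}\big([0,\infty);\mathcal{C}(\mathbb{R}^N)\cap L^\infty(\mathbb{R}^N)\big)$ be a solution of the Cauchy problem \[ u_t(x,t)=\int_{\mathbb{R}^N}J(x-y)\,\big(u(y,t)-u(x,t)\big)\,\mathcal{G}_\mu\big(x,u(y,t)-u(x,t)\big)\,dy\quad\text{in }\mathbb{R}^N\times(0,\infty),\qquad u(\cdot,0)=u_0,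 \] that is, $u(\cdot,0)=u_0$ and, for every $t>0$ and almost every $x\in\mathbb{R}^N$, \[ u(x,t)=\int_0^t\int_{\mathbb{R}^N}J(x-y)\,\big(u(y,\tau)-u(x,\tau)\big)\,\mathcal{G}_\mu\big(x,u(y,\tau)-u(x,\tau)\big)\,dy\,d\tau+u_0(x). \] Then there is a constant $\tilde C>0$, depending only on $\|\mu\|_{L^\infty(\mathbb{R}^N)}$, $\|u_0\|_{L^\infty(\mathbb{R}^N)}$, $N$ and $J$, such that, for all sufficiently large $t$ (how large may depend on $\mu$, $u_0$ and $u$), $u(\cdot,t)\in L^2(\mathbb{R}^N)$ and \[ \|u(\cdot,t)\|_{L^2(\mathbb{R}^N)}^2\le \tilde C\,\|u_0\|_{L^1(\mathbb{R}^N)}^2\,t^{-\frac N2}. \] -/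

import Mathlib

open MeasureTheory Filter Set
open scoped BoundedContinuousFunction ENNReal

namespace NonlocalKPZ

/-- The space `ℝ^N` with its Euclidean norm and Lebesgue measure. -/
abbrev RN (N : ℕ) : Type := EuclideanSpace ℝ (Fin N)

/-- The standing assumptions on the convolution kernel `J`: it is nonnegative, radially symmetric,
continuous with compact support and of integral one. (The second moment
`∫ J(z) z_N ^ 2 dz` is then automatically finite.) -/
structure IsKernel {N : ℕ} (J : RN N → ℝ) : Prop where
  nonneg : ∀ z, 0 ≤ J z
  radial : ∀ z w : RN N, ‖z‖ = ‖w‖ → J z = J w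
  continuous : Continuous J
  hasCompactSupport : HasCompactSupport J
  integral_eq_one : ∫ z, J z = 1

/-- The nonlinearity `G_μ(x, s) = 1 + μ(x) s / (2 (1 + μ(x)² s²))`. -/
noncomputable def gMu {N : ℕ} (μ : RN N → ℝ) (x : RN N) (s : ℝ) : ℝ :=
  1 + μ x * s / (2 * (1 + μ x ^ 2 * s ^ 2))

/-- The nonlocal operator
`x ↦ ∫ J(x - y) (v(y) - v(x)) G(x, v(y) - v(x)) dy`. -/
noncomputable def nonlocalOp {N : ℕ} (J : RN N → ℝ) (G : RN N → ℝ → ℝ) (v : RN N → ℝ)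
    (x : RN N) : ℝ :=
  ∫ y, J (x - y) * (v y - v x) * G x (v y - v x)

/-- `u ∈ C([0, ∞); C(ℝ^N) ∩ L^∞(ℝ^N))` is a (global in time) solution of the Cauchy problem
`u_t(x, t) = ∫ J(x - y) (u(y, t) - u(x, t)) G(x, u(y, t) - u(x, t)) dy`, `u(x, 0) = u₀(x)`.
The equation is understood in its time-integrated form. Since `G(x, s)` is only
given for almost every `x`, it is required for almost every `x`. Only the values of `u` at times
`t ≥ 0` matter. -/
structure IsCauchySolution {N : ℕ} (J : RN N → ℝ) (G : RN N → ℝ → ℝ) (u₀ : RN N → ℝ)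
    (u : ℝ → RN N →ᵇ ℝ) : Prop where
  continuousOn : ContinuousOn u (Ici 0)
  initial : ∀ x, u 0 x = u₀ x
  equation : ∀ t > 0, ∀ᵐ x : RN N,
    u t x = (∫ τ in (0 : ℝ)..t, nonlocalOp J G (u τ) x) + u₀ x

end NonlocalKPZ

namespace NonlocalKPZ

/-! Set M = ‖u₀‖_∞, m = ‖μ‖_∞ and let φ(μ, s) = s G_μ(s) be the flux. Since the factor G_μ lies in
[3/4, 5/4], the equation compares with constants (`IsFlow.lower_bound`, `IsFlow.upper_bound`), so 0
≤ u ≤ M for all time. A Gronwall-type argument keeps u(·, t) integrable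
(`IsFlow.exists_mass_bound`). The asymmetric part of the flux is at most (m/2) s². When the equation
is tested with α + 2βu, the identity 2b(a - b) = a² - b² - (a - b)² makes β produce the dissipation
-β(a - b)², while the asymmetric part costs at most (αm/2 + βMm)(a - b)². The remaining terms α(a -
b) + β(a² - b²) integrate to zero by translation invariance. As Mm < 1 the dissipation wins
(`IsFlow.entropy_le`). Taking α = 1 with a suitable β bounds the mass for all time by a multiple of
‖u₀‖_1 (`IsFlow.mass_le`); taking α = 0, β = 1 makes ‖u‖_2² decrease at rate (1 - Mm) times the
nonlocal energy. A Nash inequality at every scale r ≥ 1 (`IsKernel.exists_nash`) bounds ‖u‖_2² by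
mass²/r^N plus r² times the energy. With r² proportional to t, iteration over dyadic times gives the
rate t^(-N/2) (`eventually_decay`). The constraint r ≥ 1 reflects that the kernel does not smooth
below its own scale, and the estimate holds only for large t because the influence of the starting
value has to die out. -/

variable {N : ℕ}

/-! ### Elementary bounds and continuity of the flux. -/

/-- The flux `s (1 + m s / (2 (1 + m² s²)))` for a frozen coefficient `m`. -/
noncomputable def phi (m s : ℝ) : ℝ := s * (1 + m * s / (2 * (1 + m ^ 2 * s ^ 2)))

/-- The nonlocal operator with frozen coefficient `m`, written as an integral over increments. -/
noncomputable def flux (J : RN N → ℝ) (v : RN N → ℝ) (m : ℝ) (x : RN N) : ℝ :=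
  ∫ z, J z * phi m (v (x - z) - v x)

lemma nonlocalOp_gMu_eq_flux (J : RN N → ℝ) (μ v : RN N → ℝ) (x : RN N) :
    nonlocalOp J (gMu μ) v x = flux J v (μ x) x := by
  unfold nonlocalOp flux
  rw [← integral_sub_left_eq_self _ volume x]
  simp only [sub_sub_cancel, phi, gMu, mul_assoc]

lemma continuous_phi : Continuous fun p : ℝ × ℝ => phi p.1 p.2 := by
  unfold phi
  refine continuous_snd.mul (continuous_const.add (Continuous.div (by fun_prop) (by fun_prop) ?_))
  intro p
  positivity

/-- This is 2|a| ≤ 1 + a². It yields the constants 3/4 and 5/4 below, uniformly in the size and sign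
of the coefficient. -/
lemma abs_half_slope_le (a : ℝ) : |a / (2 * (1 + a ^ 2))| ≤ 1 / 4 := by
  rw [abs_div, abs_of_pos (by positivity : 0 < 2 * (1 + a ^ 2)), div_le_iff₀ (by positivity)]
  nlinarith [sq_nonneg (|a| - 1), sq_abs a]

lemma phi_factor_mem (m s : ℝ) :
    3 / 4 ≤ 1 + m * s / (2 * (1 + m ^ 2 * s ^ 2)) ∧
      1 + m * s / (2 * (1 + m ^ 2 * s ^ 2)) ≤ 5 / 4 := by
  have := abs_le.1 (abs_half_slope_le (m * s))
  rw [mul_pow] at this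
  constructor <;> linarith [this.1, this.2]

lemma abs_phi_le (m s : ℝ) : |phi m s| ≤ 5 / 4 * |s| := by
  obtain ⟨h1, h2⟩ := phi_factor_mem m s
  rw [phi, abs_mul, abs_of_nonneg (by linarith : (0:ℝ) ≤ 1 + m * s / (2 * (1 + m ^ 2 * s ^ 2)))]
  nlinarith [abs_nonneg s]

lemma neg_le_phi {m s d : ℝ} (hd : 0 ≤ d) (h : -d ≤ s) : -(5 / 4 * d) ≤ phi m s := by
  obtain ⟨h1, h2⟩ := phi_factor_mem m s
  unfold phi
  rcases le_total 0 s with hs | hs <;> nlinarith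

lemma phi_le {m s d : ℝ} (hd : 0 ≤ d) (h : s ≤ d) : phi m s ≤ 5 / 4 * d := by
  obtain ⟨h1, h2⟩ := phi_factor_mem m s
  unfold phi
  rcases le_total 0 s with hs | hs <;> nlinarith

lemma phi_sub_le {m a b : ℝ} (ha : 0 ≤ a) (hb : 0 ≤ b) : phi m (a - b) ≤ 5 / 4 * a :=
  phi_le ha (by linarith)

lemma IsKernel.integrable {J : RN N → ℝ} (hJ : IsKernel J) : Integrable J :=
  hJ.continuous.integrable_of_hasCompactSupport hJ.hasCompactSupport

lemma IsKernel.integrable_mul {J : RN N → ℝ} (hJ : IsKernel J) {f : RN N → ℝ}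
    (hf : Continuous f) : Integrable fun z => J z * f z :=
  (hJ.continuous.mul hf).integrable_of_hasCompactSupport hJ.hasCompactSupport.mul_right

lemma IsKernel.integral_mul_right {J : RN N → ℝ} (hJ : IsKernel J) (c : ℝ) :
    ∫ z, J z * c = c := by
  rw [integral_mul_const, hJ.integral_eq_one, one_mul]

/-- Integrals against a kernel depend continuously on parameters. -/
lemma IsKernel.continuous_integral {X : Type*} [TopologicalSpace X] [FirstCountableTopology X]
    [LocallyCompactSpace X] {J : RN N → ℝ} (hJ : IsKernel J) {f : X → RN N → ℝ}
    (hf : Continuous f.uncurry) : Continuous fun p => ∫ z, J z * f p z := by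
  have h : ∀ p, ∫ z, J z * f p z = ∫ z in tsupport J, J z * f p z := fun p =>
    (setIntegral_eq_integral_of_forall_compl_eq_zero fun z hz => by
      rw [image_eq_zero_of_notMem_tsupport hz, zero_mul]).symm
  simp_rw [h]
  refine continuous_parametric_integral_of_continuous (f := fun p z => J z * f p z) ?_
    hJ.hasCompactSupport
  exact (hJ.continuous.comp continuous_snd).mul hf

lemma continuous_eval_of_continuous {u : ℝ → RN N →ᵇ ℝ} (hu : Continuous u) {X : Type*}
    [TopologicalSpace X] {f : X → ℝ} {g : X → RN N} (hf : Continuous f) (hg : Continuous g) :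
    Continuous fun p => u (f p) (g p) :=
  (hu.comp hf).eval hg

/-- The coefficient is an independent variable here: joint continuity in (t, m, x) can then be
composed with a merely measurable μ. -/
lemma IsKernel.continuous_flux {J : RN N → ℝ} (hJ : IsKernel J) {u : ℝ → RN N →ᵇ ℝ}
    (hu : Continuous u) :
    Continuous fun p : ℝ × ℝ × RN N => flux J (u p.1) p.2.1 p.2.2 := by
  refine hJ.continuous_integral (f := fun (p : ℝ × ℝ × RN N) z =>
    phi p.2.1 (u p.1 (p.2.2 - z) - u p.1 p.2.2)) ?_
  refine continuous_phi.comp (Continuous.prodMk (by fun_prop) (Continuous.sub ?_ ?_)) <;>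
  exact continuous_eval_of_continuous hu (by fun_prop) (by fun_prop)

/-! ### From the integrated equation to a pointwise differential equation. -/

/-- A global-in-time version of the evolution: the curve is continuous on the whole real line and
satisfies the equation pointwise in positive time, for almost every point. -/
structure IsFlow (J : RN N → ℝ) (μ : RN N → ℝ) (u : ℝ → RN N →ᵇ ℝ) : Prop where
  continuous : Continuous u
  hasDerivAt : ∀ᵐ x, ∀ t > 0, HasDerivAt (fun t => u t x) (flux J (u t) (μ x) x) t

lemma IsCauchySolution.isFlow {J μ u₀ : RN N → ℝ} (hJ : IsKernel J) {u : ℝ → RN N →ᵇ ℝ}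
    (hu : IsCauchySolution J (gMu μ) u₀ u) : IsFlow J μ fun t => u (max t 0) := by
  have hc : Continuous fun t : ℝ => u (max t 0) :=
    hu.continuousOn.comp_continuous (by fun_prop) fun t => le_max_right t 0
  refine ⟨hc, ?_⟩
  -- The exceptional null set of the equation depends on t. Countably many rational times share one
  -- null set, and continuity in t extends the identity to all positive times.
  have hq : ∀ᵐ x, ∀ q : ℚ, 0 < (q : ℝ) →
      u q x = (∫ τ in (0 : ℝ)..q, nonlocalOp J (gMu μ) (u τ) x) + u₀ x := by
    rw [ae_all_iff]
    intro q
    by_cases hq : 0 < (q : ℝ)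
    · filter_upwards [hu.equation q hq] with x hx _ using hx
    · exact .of_forall fun x h => absurd h hq
  filter_upwards [hq] with x hx
  have hF : Continuous fun τ : ℝ => flux J (u (max τ 0)) (μ x) x :=
    (hJ.continuous_flux hc).comp (by fun_prop : Continuous fun τ : ℝ => (τ, μ x, x))
  have hI : ∀ t : ℝ, HasDerivAt (fun t => (∫ τ in (0:ℝ)..t, flux J (u (max τ 0)) (μ x) x) + u₀ x)
      (flux J (u (max t 0)) (μ x) x) t := fun t =>
    (hF.integral_hasStrictDerivAt 0 t).hasDerivAt.add_const _
  have hIc : Continuous fun t => (∫ τ in (0:ℝ)..t, flux J (u (max τ 0)) (μ x) x) + u₀ x :=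
    continuous_iff_continuousAt.2 fun t => (hI t).continuousAt
  have huc : Continuous fun t : ℝ => u (max t 0) x :=
    continuous_eval_of_continuous hc continuous_id continuous_const
  have heq : ∀ t > 0, u (max t 0) x =
      (∫ τ in (0:ℝ)..t, flux J (u (max τ 0)) (μ x) x) + u₀ x := by
    have hcl : IsClosed {t : ℝ | u (max t 0) x =
      (∫ τ in (0:ℝ)..t, flux J (u (max τ 0)) (μ x) x) + u₀ x} := isClosed_eq huc hIc
    intro t ht
    have hd : t ∈ closure (Ioi (0:ℝ) ∩ range ((↑) : ℚ → ℝ)) :=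
      Rat.isDenseEmbedding_coe_real.dense.open_subset_closure_inter isOpen_Ioi ht
    refine hcl.closure_subset_iff.2 ?_ hd
    rintro _ ⟨hq, q, rfl⟩
    have hq' : 0 < (q : ℝ) := hq
    rw [mem_ofPred_eq, max_eq_left hq'.le, hx q hq']
    congr 1
    refine intervalIntegral.integral_congr fun τ hτ => ?_
    rw [uIcc_of_le hq'.le] at hτ
    simp only [nonlocalOp_gMu_eq_flux, max_eq_left hτ.1]
  intro t ht
  refine (hI t).congr_of_eventuallyEq ?_
  filter_upwards [lt_mem_nhds ht] with s hs using heq s hs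

/-! ### Comparison with constants. -/

lemma IsKernel.integrable_flux {J : RN N → ℝ} (hJ : IsKernel J) {v : RN N → ℝ}
    (hv : Continuous v) (m : ℝ) (x : RN N) :
    Integrable fun z => J z * phi m (v (x - z) - v x) :=
  hJ.integrable_mul (continuous_phi.comp
    (by fun_prop : Continuous fun z => (m, v (x - z) - v x)))

lemma IsKernel.neg_le_flux {J : RN N → ℝ} (hJ : IsKernel J) {v : RN N → ℝ} (hv : Continuous v)
    {k : ℝ} (hk : ∀ x, k ≤ v x) (m : ℝ) (x : RN N) : -(5 / 4 * (v x - k)) ≤ flux J v m x := by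
  rw [← hJ.integral_mul_right (-(5 / 4 * (v x - k)))]
  refine integral_mono (hJ.integrable.mul_const _) (hJ.integrable_flux hv m x) fun z => ?_
  exact mul_le_mul_of_nonneg_left
    (neg_le_phi (by linarith [hk x]) (by linarith [hk (x - z)])) (hJ.nonneg z)

/-- The flux is odd under a simultaneous change of sign of m and s. As flows carry no sign condition
on μ, upper bounds follow from lower bounds for -u. -/
lemma flux_neg (J v : RN N → ℝ) (m : ℝ) (x : RN N) :
    flux J (-v) (-m) x = -flux J v m x := by
  unfold flux
  rw [← integral_neg]
  congr 1 with z
  simp only [phi, Pi.neg_apply]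
  ring

lemma IsFlow.neg {J μ : RN N → ℝ} {u : ℝ → RN N →ᵇ ℝ} (hu : IsFlow J μ u) :
    IsFlow J (-μ) (-u) := by
  refine ⟨hu.continuous.neg, ?_⟩
  filter_upwards [hu.hasDerivAt] with x hx t ht
  have := (hx t ht).neg
  rw [← flux_neg] at this
  exact this

lemma IsFlow.continuous_apply {J μ : RN N → ℝ} {u : ℝ → RN N →ᵇ ℝ} (hu : IsFlow J μ u)
    (x : RN N) : Continuous fun t => u t x :=
  continuous_eval_of_continuous hu.continuous continuous_id continuous_const

/-- A lower bound `k - b` on a time interval improves itself when `k` bounds the initial datum. -/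
lemma IsFlow.improve_lower_bound {J μ : RN N → ℝ} (hJ : IsKernel J) {u : ℝ → RN N →ᵇ ℝ}
    (hu : IsFlow J μ u) {k b T : ℝ} (h0 : ∀ x, k ≤ u 0 x)
    (h : ∀ t ∈ Icc 0 T, ∀ x, k - b ≤ u t x) :
    ∀ t ∈ Icc 0 T, ∀ x, k - b * (1 - Real.exp (-(5 / 4 * T))) ≤ u t x := by
  intro t ht
  have hcl : IsClosed {x | k - b * (1 - Real.exp (-(5 / 4 * T))) ≤ u t x} :=
    isClosed_le continuous_const (u t).continuous
  have hae : ∀ᵐ x, k - b * (1 - Real.exp (-(5 / 4 * T))) ≤ u t x := by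
    filter_upwards [hu.hasDerivAt] with x hx
    -- The flux at x is at least -(5/4)(u - (k - b)), so this integrating factor makes the product
    -- nondecreasing. It starts at b or more, which leaves a gain of b exp(-5T/4).
    have hmono : MonotoneOn (fun s => Real.exp (5 / 4 * s) * (u s x - (k - b))) (Icc 0 T) := by
      have hd : ∀ s > 0, HasDerivAt (fun s => Real.exp (5 / 4 * s) * (u s x - (k - b)))
          (Real.exp (5 / 4 * s) * (5 / 4 * 1) * (u s x - (k - b)) +
            Real.exp (5 / 4 * s) * flux J (u s) (μ x) x) s := fun s hs =>
        (((hasDerivAt_id s).const_mul (5 / 4)).exp).mul ((hx s hs).sub_const _)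
      refine monotoneOn_of_deriv_nonneg (convex_Icc 0 T) ?_ ?_ ?_
      · have := hu.continuous_apply x
        fun_prop
      · intro s hs
        rw [interior_Icc] at hs
        exact (hd s hs.1).differentiableAt.differentiableWithinAt
      · intro s hs
        rw [interior_Icc] at hs
        rw [(hd s hs.1).deriv]
        have := hJ.neg_le_flux (u s).continuous (h s ⟨hs.1.le, hs.2.le⟩) (μ x) x
        have he := Real.exp_pos (5 / 4 * s)
        nlinarith
    have h1 := hmono ⟨le_rfl, ht.1.trans ht.2⟩ ht ht.1
    simp only [mul_zero, Real.exp_zero, one_mul] at h1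
    have h2 : b ≤ Real.exp (5 / 4 * T) * (u t x - (k - b)) := by
      have h3 : Real.exp (5 / 4 * t) ≤ Real.exp (5 / 4 * T) := by
        rw [Real.exp_le_exp]; linarith [ht.2]
      have := mul_le_mul_of_nonneg_right h3 (sub_nonneg.2 (h t ht x))
      linarith [h0 x]
    have h4 : b * Real.exp (-(5 / 4 * T)) ≤ u t x - (k - b) := by
      rw [Real.exp_neg, ← div_eq_mul_inv, div_le_iff₀' (Real.exp_pos _)]
      exact h2
    linarith
  intro x
  have := (Measure.dense_of_ae hae) x
  exact hcl.closure_subset this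

/-- The comparison principle with constants from below. -/
lemma IsFlow.lower_bound {J μ : RN N → ℝ} (hJ : IsKernel J) {u : ℝ → RN N →ᵇ ℝ}
    (hu : IsFlow J μ u) {k : ℝ} (h0 : ∀ x, k ≤ u 0 x) {t : ℝ} (ht : 0 ≤ t) (x : RN N) :
    k ≤ u t x := by
  obtain ⟨b, hb⟩ := (isCompact_Icc (a := (0:ℝ)) (b := t)).exists_bound_of_continuousOn
    hu.continuous.continuousOn
  -- The crude bound u ≥ -|b| starts the iteration with defect c. Each improvement multiplies the
  -- defect by q < 1, so it tends to 0.
  set c : ℝ := |k| + |b|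
  set q : ℝ := 1 - Real.exp (-(5 / 4 * t))
  have hq0 : 0 ≤ q := sub_nonneg.2 (Real.exp_le_one_iff.2 (by linarith))
  have hq1 : q < 1 := sub_lt_self _ (Real.exp_pos _)
  have hstep : ∀ n : ℕ, ∀ s ∈ Icc 0 t, ∀ x, k - c * q ^ n ≤ u s x := by
    intro n
    induction n with
    | zero =>
      intro s hs x
      have h1 := ((u s).norm_coe_le_norm x).trans (hb s hs)
      rw [Real.norm_eq_abs] at h1
      simp only [pow_zero, mul_one, c]
      linarith [neg_abs_le (u s x), le_abs_self k, le_abs_self b]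
    | succ n ih =>
      have := hu.improve_lower_bound hJ h0 ih
      intro s hs x
      rw [pow_succ, ← mul_assoc]
      exact this s hs x
  have hlim : Tendsto (fun n : ℕ => k - c * q ^ n) atTop (nhds (k - c * 0)) :=
    ((tendsto_pow_atTop_nhds_zero_of_lt_one hq0 hq1).const_mul c).const_sub k
  rw [mul_zero, sub_zero] at hlim
  exact le_of_tendsto' hlim fun n => hstep n t ⟨ht, le_rfl⟩ x

lemma IsFlow.upper_bound {J μ : RN N → ℝ} (hJ : IsKernel J) {u : ℝ → RN N →ᵇ ℝ}
    (hu : IsFlow J μ u) {k : ℝ} (h0 : ∀ x, u 0 x ≤ k) {t : ℝ} (ht : 0 ≤ t) (x : RN N) :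
    u t x ≤ k :=
  neg_le_neg_iff.1 (hu.neg.lower_bound hJ (k := -k) (fun x => neg_le_neg (h0 x)) ht x)

/-! ### Propagation of integrability. -/

lemma IsFlow.sub_eq_integral {J μ : RN N → ℝ} (hJ : IsKernel J) {u : ℝ → RN N →ᵇ ℝ}
    (hu : IsFlow J μ u) :
    ∀ᵐ x, ∀ s t : ℝ, 0 ≤ s → s ≤ t → u t x - u s x = ∫ τ in s..t, flux J (u τ) (μ x) x := by
  filter_upwards [hu.hasDerivAt] with x hx s t hs hst
  have hF : Continuous fun τ : ℝ => flux J (u τ) (μ x) x :=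
    (hJ.continuous_flux hu.continuous).comp (by fun_prop : Continuous fun τ : ℝ => (τ, μ x, x))
  exact (intervalIntegral.integral_eq_sub_of_hasDerivAt_of_le hst
    (hu.continuous_apply x).continuousOn (fun τ hτ => hx τ (hs.trans_lt hτ.1))
    (hF.intervalIntegrable s t)).symm

lemma IsKernel.flux_le {J : RN N → ℝ} (hJ : IsKernel J) {v : RN N → ℝ} (hv : Continuous v)
    (hv0 : ∀ x, 0 ≤ v x) (m : ℝ) (x : RN N) : flux J v m x ≤ 5 / 4 * ∫ z, J z * v (x - z) := by
  rw [← integral_const_mul]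
  refine integral_mono (hJ.integrable_flux hv m x)
    ((hJ.integrable_mul (by fun_prop : Continuous fun z => v (x - z))).const_mul _) fun z => ?_
  calc J z * phi m (v (x - z) - v x) ≤ J z * (5 / 4 * v (x - z)) :=
        mul_le_mul_of_nonneg_left (phi_sub_le (hv0 _) (hv0 _)) (hJ.nonneg z)
    _ = _ := by ring

/-- Only the gain term of the flux is kept. With values in `ℝ≥0∞`, Tonelli applies before
integrability of u(·, t) is known. -/
lemma IsFlow.ofReal_le {J μ : RN N → ℝ} (hJ : IsKernel J) {u : ℝ → RN N →ᵇ ℝ}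
    (hu : IsFlow J μ u) (h0 : ∀ t, 0 ≤ t → ∀ x, 0 ≤ u t x) :
    ∀ᵐ x, ∀ s t : ℝ, 0 ≤ s → s ≤ t → ENNReal.ofReal (u t x) ≤ ENNReal.ofReal (u s x) +
      ENNReal.ofReal (5 / 4) * ∫⁻ τ in Ioc s t, ∫⁻ z,
        ENNReal.ofReal (J z) * ENNReal.ofReal (u τ (x - z)) := by
  filter_upwards [hu.sub_eq_integral hJ] with x hx s t hs hst
  have hF : Continuous fun τ : ℝ => flux J (u τ) (μ x) x :=
    (hJ.continuous_flux hu.continuous).comp (by fun_prop : Continuous fun τ : ℝ => (τ, μ x, x))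
  have hC : Continuous fun τ : ℝ => ∫ z, J z * u τ (x - z) :=
    hJ.continuous_integral (f := fun τ z => u τ (x - z))
      (continuous_eval_of_continuous hu.continuous (by fun_prop) (by fun_prop))
  have h1 : u t x ≤ u s x + 5 / 4 * ∫ τ in s..t, ∫ z, J z * u τ (x - z) := by
    rw [← intervalIntegral.integral_const_mul]
    have := hx s t hs hst
    have h2 := intervalIntegral.integral_mono_on (μ := volume) hst (hF.intervalIntegrable s t)
      ((hC.const_mul (5 / 4)).intervalIntegrable s t)
      (fun τ hτ => hJ.flux_le (u τ).continuous (h0 τ (hs.trans hτ.1)) (μ x) x)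
    linarith
  have hnn : ∀ τ ∈ Ioc s t, ∀ z, 0 ≤ J z * u τ (x - z) := fun τ hτ z =>
    mul_nonneg (hJ.nonneg z) (h0 τ (hs.trans hτ.1.le) _)
  have h3 : ENNReal.ofReal (∫ τ in s..t, ∫ z, J z * u τ (x - z)) =
      ∫⁻ τ in Ioc s t, ∫⁻ z, ENNReal.ofReal (J z) * ENNReal.ofReal (u τ (x - z)) := by
    rw [intervalIntegral.integral_of_le hst, ofReal_integral_eq_lintegral_ofReal]
    · refine setLIntegral_congr_fun measurableSet_Ioc fun τ hτ => ?_
      rw [ofReal_integral_eq_lintegral_ofReal]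
      · simp_rw [ENNReal.ofReal_mul (hJ.nonneg _)]
      · exact hJ.integrable_mul (f := fun z => u τ (x - z)) (by fun_prop)
      · exact .of_forall (hnn τ hτ)
    · exact (hC.intervalIntegrable s t).1
    · exact (ae_restrict_iff' measurableSet_Ioc).2
        (.of_forall fun τ hτ => integral_nonneg (hnn τ hτ))
  calc ENNReal.ofReal (u t x)
      ≤ ENNReal.ofReal (u s x + 5 / 4 * ∫ τ in s..t, ∫ z, J z * u τ (x - z)) :=
        ENNReal.ofReal_le_ofReal h1
    _ ≤ ENNReal.ofReal (u s x) + ENNReal.ofReal (5 / 4 * ∫ τ in s..t, ∫ z, J z * u τ (x - z)) :=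
        ENNReal.ofReal_add_le
    _ = _ := by rw [ENNReal.ofReal_mul (by norm_num), h3]

lemma IsKernel.lintegral_eq_one {J : RN N → ℝ} (hJ : IsKernel J) :
    ∫⁻ z, ENNReal.ofReal (J z) = 1 := by
  rw [← ofReal_integral_eq_lintegral_ofReal hJ.integrable (.of_forall hJ.nonneg),
    hJ.integral_eq_one, ENNReal.ofReal_one]

/-- Weighted masses of nonnegative flows satisfy an integral inequality, if the weight varies by at
most a factor two at the scale of the kernel. -/
lemma IsFlow.weighted_mass_le {J μ : RN N → ℝ} (hJ : IsKernel J) {u : ℝ → RN N →ᵇ ℝ}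
    (hu : IsFlow J μ u) (h0 : ∀ t, 0 ≤ t → ∀ x, 0 ≤ u t x) {w : RN N → ℝ≥0∞} (hw : Measurable w)
    (hw2 : ∀ x z, J z ≠ 0 → w (x + z) ≤ 2 * w x) {s t : ℝ} (hs : 0 ≤ s) (hst : s ≤ t) :
    ∫⁻ x, w x * ENNReal.ofReal (u t x) ≤ (∫⁻ x, w x * ENNReal.ofReal (u s x)) +
      ENNReal.ofReal (5 / 4) *
        ∫⁻ τ in Ioc s t, 2 * ∫⁻ x, w x * ENNReal.ofReal (u τ x) := by
  have hJm : Measurable J := hJ.continuous.measurable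
  have hu3 : Measurable fun p : (RN N × ℝ) × RN N => u p.1.2 (p.1.1 - p.2) :=
    (continuous_eval_of_continuous hu.continuous (by fun_prop) (by fun_prop)).measurable
  have hmeas3 : Measurable fun p : (RN N × ℝ) × RN N =>
      ENNReal.ofReal (J p.2) * ENNReal.ofReal (u p.1.2 (p.1.1 - p.2)) :=
    (ENNReal.measurable_ofReal.comp (hJm.comp measurable_snd)).mul
      (ENNReal.measurable_ofReal.comp hu3)
  have hmeas2 : Measurable fun p : RN N × ℝ =>
      ∫⁻ z, ENNReal.ofReal (J z) * ENNReal.ofReal (u p.2 (p.1 - z)) :=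
    hmeas3.lintegral_prod_right'
  have hus : ∀ τ, Measurable (u τ) := fun τ => (u τ).continuous.measurable
  calc ∫⁻ x, w x * ENNReal.ofReal (u t x)
      ≤ ∫⁻ x, (w x * ENNReal.ofReal (u s x) + ENNReal.ofReal (5 / 4) *
          (w x * ∫⁻ τ in Ioc s t, ∫⁻ z, ENNReal.ofReal (J z) * ENNReal.ofReal (u τ (x - z)))) := by
        refine lintegral_mono_ae ?_
        filter_upwards [hu.ofReal_le hJ h0] with x hx
        refine (mul_le_mul_right (hx s t hs hst) (w x)).trans (le_of_eq ?_)
        ring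
    _ = (∫⁻ x, w x * ENNReal.ofReal (u s x)) + ENNReal.ofReal (5 / 4) *
          ∫⁻ x, (w x * ∫⁻ τ in Ioc s t, ∫⁻ z,
            ENNReal.ofReal (J z) * ENNReal.ofReal (u τ (x - z))) := by
        have := hus s
        rw [lintegral_add_left (by fun_prop), lintegral_const_mul]
        exact hw.mul hmeas2.lintegral_prod_right'
    _ = (∫⁻ x, w x * ENNReal.ofReal (u s x)) + ENNReal.ofReal (5 / 4) *
          ∫⁻ τ in Ioc s t, ∫⁻ x, w x * ∫⁻ z,
            ENNReal.ofReal (J z) * ENNReal.ofReal (u τ (x - z)) := by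
        congr 2
        rw [← lintegral_lintegral_swap]
        · refine lintegral_congr fun x => ?_
          rw [lintegral_const_mul]
          exact hmeas2.comp measurable_prodMk_left
        · exact ((hw.comp measurable_fst).mul hmeas2).aemeasurable
    _ ≤ _ := by
        gcongr with τ
        have := hus τ
        calc ∫⁻ x, w x * ∫⁻ z, ENNReal.ofReal (J z) * ENNReal.ofReal (u τ (x - z))
            = ∫⁻ x, ∫⁻ z, w x * (ENNReal.ofReal (J z) * ENNReal.ofReal (u τ (x - z))) := by
              refine lintegral_congr fun x => ?_
              rw [lintegral_const_mul]
              fun_prop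
          _ = ∫⁻ z, ∫⁻ x, w x * (ENNReal.ofReal (J z) * ENNReal.ofReal (u τ (x - z))) := by
              refine lintegral_lintegral_swap (Measurable.aemeasurable ?_)
              unfold Function.uncurry
              fun_prop
          _ = ∫⁻ z, ∫⁻ x, w (x + z) * (ENNReal.ofReal (J z) * ENNReal.ofReal (u τ x)) := by
              refine lintegral_congr fun z => ?_
              rw [← lintegral_add_right_eq_self _ z]
              simp only [add_sub_cancel_right]
          _ ≤ ∫⁻ z, ∫⁻ x, ENNReal.ofReal (J z) * (2 * (w x * ENNReal.ofReal (u τ x))) := by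
              refine lintegral_mono fun z => lintegral_mono fun x => ?_
              by_cases hz : J z = 0
              · simp [hz]
              · calc w (x + z) * (ENNReal.ofReal (J z) * ENNReal.ofReal (u τ x))
                    ≤ 2 * w x * (ENNReal.ofReal (J z) * ENNReal.ofReal (u τ x)) := by
                      gcongr; exact hw2 x z hz
                  _ = _ := by ring
          _ = ∫⁻ z, ENNReal.ofReal (J z) * ∫⁻ x, 2 * (w x * ENNReal.ofReal (u τ x)) := by
              refine lintegral_congr fun z => ?_
              rw [lintegral_const_mul]
              fun_prop
          _ = 2 * ∫⁻ x, w x * ENNReal.ofReal (u τ x) := by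
              rw [lintegral_mul_const _ (by fun_prop), hJ.lintegral_eq_one, one_mul,
                lintegral_const_mul _ (by fun_prop)]

/-- Let S be the supremum of the weighted masses over the interval. The integral inequality gives S
≤ I(s) + (5/4)·2·(1/5)·S = I(s) + S/2. An integrable weight and the bound u ≤ M make S finite, so
S/2 can be absorbed. -/
lemma IsFlow.weighted_mass_le_two_mul {J μ : RN N → ℝ} (hJ : IsKernel J) {u : ℝ → RN N →ᵇ ℝ}
    (hu : IsFlow J μ u) (h0 : ∀ t, 0 ≤ t → ∀ x, 0 ≤ u t x) {M : ℝ}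
    (hM : ∀ t, 0 ≤ t → ∀ x, u t x ≤ M) {w : RN N → ℝ≥0∞} (hw : Measurable w)
    (hw2 : ∀ x z, J z ≠ 0 → w (x + z) ≤ 2 * w x) (hwi : ∫⁻ x, w x ≠ ∞) {s t : ℝ} (hs : 0 ≤ s)
    (ht : t ∈ Icc s (s + 1 / 5)) :
    ∫⁻ x, w x * ENNReal.ofReal (u t x) ≤ 2 * ∫⁻ x, w x * ENNReal.ofReal (u s x) := by
  set I : ℝ → ℝ≥0∞ := fun t => ∫⁻ x, w x * ENNReal.ofReal (u t x) with hI
  set S : ℝ≥0∞ := ⨆ τ ∈ Icc s (s + 1 / 5), I τ with hS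
  have hIS : ∀ τ ∈ Icc s (s + 1 / 5), I τ ≤ S := fun τ hτ => le_iSup₂ (f := fun τ _ => I τ) τ hτ
  have hSfin : S ≠ ∞ := by
    refine ne_top_of_le_ne_top (b := (∫⁻ x, w x) * ENNReal.ofReal M)
      (ENNReal.mul_ne_top hwi ENNReal.ofReal_ne_top) (iSup₂_le fun τ hτ => ?_)
    rw [← lintegral_mul_const _ hw]
    refine lintegral_mono fun x => ?_
    dsimp only
    gcongr
    exact hM τ (hs.trans hτ.1) x
  have hstep : S ≤ I s + S / 2 := by
    refine iSup₂_le fun τ hτ => ?_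
    refine (hu.weighted_mass_le hJ h0 hw hw2 hs hτ.1).trans ?_
    gcongr
    calc ENNReal.ofReal (5 / 4) * ∫⁻ σ in Ioc s τ, 2 * I σ
        ≤ ENNReal.ofReal (5 / 4) * ∫⁻ σ in Ioc s τ, 2 * S := by
          gcongr 1
          refine setLIntegral_mono measurable_const fun σ hσ => ?_
          gcongr
          exact hIS σ ⟨hσ.1.le, hσ.2.trans hτ.2⟩
      _ = ENNReal.ofReal (5 / 4) * (2 * S * ENNReal.ofReal (τ - s)) := by
          rw [setLIntegral_const, Real.volume_Ioc]
      _ ≤ ENNReal.ofReal (5 / 4) * (2 * S * ENNReal.ofReal (1 / 5)) := by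
          gcongr
          linarith [hτ.2]
      _ = S * (ENNReal.ofReal (5 / 4) * ENNReal.ofReal 2 * ENNReal.ofReal (1 / 5)) := by
          rw [ENNReal.ofReal_ofNat]; ring
      _ = S / 2 := by
          rw [← ENNReal.ofReal_mul (by norm_num), ← ENNReal.ofReal_mul (by norm_num),
            ENNReal.div_eq_inv_mul, mul_comm]
          congr 1
          rw [← ENNReal.ofReal_ofNat, ← ENNReal.ofReal_inv_of_pos (by norm_num)]
          norm_num
  have hhalf : S / 2 ≤ I s := by
    have h1 : S / 2 + S / 2 ≤ I s + S / 2 := by rwa [ENNReal.add_halves]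
    exact (ENNReal.add_le_add_iff_right (ENNReal.div_ne_top hSfin (by norm_num))).1 h1
  calc I t ≤ S := hIS t ht
    _ = 2 * (S / 2) := (ENNReal.mul_div_cancel (by norm_num) (by norm_num)).symm
    _ ≤ 2 * I s := by gcongr

/-- A polynomially decaying integrable weight, which tends to one as `ε` tends to zero. -/
noncomputable def weight (N : ℕ) (ε : ℝ) (x : RN N) : ℝ≥0∞ :=
  ENNReal.ofReal ((1 + ‖ε • x‖) ^ (-(N + 1 : ℝ)))

lemma measurable_weight (ε : ℝ) : Measurable (weight N ε) := by
  unfold weight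
  fun_prop

lemma lintegral_weight_ne_top {ε : ℝ} (hε : ε ≠ 0) : ∫⁻ x, weight N ε x ≠ ∞ := by
  have h1 : Integrable fun x : RN N => (1 + ‖x‖) ^ (-(N + 1 : ℝ)) :=
    integrable_one_add_norm (by simp)
  have h2 := h1.comp_smul hε
  exact h2.lintegral_lt_top.ne

lemma weight_le_one (ε : ℝ) (x : RN N) : weight N ε x ≤ 1 := by
  rw [weight, ENNReal.ofReal_le_one]
  exact Real.rpow_le_one_of_one_le_of_nonpos (by linarith [norm_nonneg (ε • x)])
    (by have : (0:ℝ) ≤ N := by positivity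
        linarith)

lemma tendsto_weight (x : RN N) : Tendsto (fun ε => weight N ε x) (nhds 0) (nhds 1) := by
  have h : Continuous fun ε : ℝ => (1 + ‖ε • x‖) ^ (-(N + 1 : ℝ)) :=
    Continuous.rpow_const (by fun_prop) fun ε => Or.inl (by positivity)
  have := ENNReal.tendsto_ofReal (h.tendsto 0)
  simpa [weight] using this

/-- The triangle inequality gives 1 + ε|x| ≤ (1 + ε|x + z|)(1 + ερ). The second factor, raised to
the power N + 1, is at most 2 once ε is small. -/
lemma weight_add_le {ρ ε : ℝ} (hε : 0 ≤ ε) (h2 : (1 + ε * ρ) ^ (N + 1 : ℝ) ≤ 2) (x z : RN N)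
    (hz : ‖z‖ ≤ ρ) : weight N ε (x + z) ≤ 2 * weight N ε x := by
  have hρ : 0 ≤ ρ := (norm_nonneg z).trans hz
  have h1 : 1 + ‖ε • x‖ ≤ (1 + ‖ε • (x + z)‖) * (1 + ε * ρ) := by
    have h3 : ‖ε • x‖ ≤ ‖ε • (x + z)‖ + ε * ρ := by
      have h4 : ε • x = ε • (x + z) - ε • z := by rw [smul_add, add_sub_cancel_right]
      calc ‖ε • x‖ ≤ ‖ε • (x + z)‖ + ‖ε • z‖ := by rw [h4]; exact norm_sub_le _ _
        _ ≤ _ := by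
          rw [norm_smul ε z, Real.norm_of_nonneg hε]
          gcongr
    nlinarith [mul_nonneg (norm_nonneg (ε • (x + z))) (mul_nonneg hε hρ)]
  unfold weight
  rw [show ∀ y : ℝ, (2 : ℝ≥0∞) * ENNReal.ofReal y = ENNReal.ofReal (2 * y) from fun y => by
    rw [ENNReal.ofReal_mul (by norm_num), ENNReal.ofReal_ofNat]]
  refine ENNReal.ofReal_le_ofReal ?_
  have hN : (0:ℝ) ≤ N + 1 := by positivity
  rw [Real.rpow_neg (by positivity), Real.rpow_neg (by positivity), ← div_eq_mul_inv,
    inv_le_comm₀ (by positivity) (by positivity), inv_div, div_le_iff₀ (by norm_num)]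
  calc (1 + ‖ε • x‖) ^ (N + 1 : ℝ) ≤ ((1 + ‖ε • (x + z)‖) * (1 + ε * ρ)) ^ (N + 1 : ℝ) := by
        gcongr
    _ = (1 + ‖ε • (x + z)‖) ^ (N + 1 : ℝ) * (1 + ε * ρ) ^ (N + 1 : ℝ) :=
        Real.mul_rpow (by positivity) (by positivity)
    _ ≤ _ := by gcongr

lemma IsKernel.exists_radius {J : RN N → ℝ} (hJ : IsKernel J) :
    ∃ ρ : ℝ, 0 ≤ ρ ∧ ∀ z, J z ≠ 0 → ‖z‖ ≤ ρ := by
  obtain ⟨ρ, hρ⟩ := hJ.hasCompactSupport.isBounded.exists_norm_le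
  exact ⟨|ρ|, abs_nonneg _, fun z hz =>
    (hρ z (subset_tsupport J hz)).trans (le_abs_self ρ)⟩

/-- The mass of a bounded nonnegative flow at most doubles in a short time. -/
lemma IsFlow.mass_le_two_mul {J μ : RN N → ℝ} (hJ : IsKernel J) {u : ℝ → RN N →ᵇ ℝ}
    (hu : IsFlow J μ u) (h0 : ∀ t, 0 ≤ t → ∀ x, 0 ≤ u t x) {M : ℝ}
    (hM : ∀ t, 0 ≤ t → ∀ x, u t x ≤ M) {s t : ℝ} (hs : 0 ≤ s) (ht : t ∈ Icc s (s + 1 / 5)) :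
    ∫⁻ x, ENNReal.ofReal (u t x) ≤ 2 * ∫⁻ x, ENNReal.ofReal (u s x) := by
  obtain ⟨ρ, hρ0, hρ⟩ := hJ.exists_radius
  have hev : ∀ᶠ ε : ℝ in nhds 0, (1 + ε * ρ) ^ (N + 1 : ℝ) ≤ 2 := by
    have hc : ContinuousAt (fun ε : ℝ => (1 + ε * ρ) ^ (N + 1 : ℝ)) 0 :=
      ContinuousAt.rpow_const (by fun_prop) (Or.inl (by simp))
    have : (fun ε : ℝ => (1 + ε * ρ) ^ (N + 1 : ℝ)) 0 < 2 := by simp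
    exact (hc.eventually_lt continuousAt_const this).mono fun _ h => h.le
  have hlim : Tendsto (fun n : ℕ => 1 / ((n : ℝ) + 1)) atTop (nhds 0) :=
    tendsto_one_div_add_atTop_nhds_zero_nat
  have hmeas : Measurable fun x => ENNReal.ofReal (u t x) :=
    ENNReal.measurable_ofReal.comp (u t).continuous.measurable
  -- Fatou's lemma along ε = 1/(n + 1) removes the weight, since the factor 2 does not depend on ε.
  calc ∫⁻ x, ENNReal.ofReal (u t x)
      = ∫⁻ x, liminf (fun n : ℕ => weight N (1 / ((n : ℝ) + 1)) x * ENNReal.ofReal (u t x))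
          atTop := by
        refine lintegral_congr fun x => ?_
        have h1 := ENNReal.Tendsto.mul_const (b := ENNReal.ofReal (u t x))
          ((tendsto_weight x).comp hlim) (Or.inr ENNReal.ofReal_ne_top)
        rw [one_mul] at h1
        exact h1.liminf_eq.symm
    _ ≤ liminf (fun n : ℕ => ∫⁻ x, weight N (1 / ((n : ℝ) + 1)) x * ENNReal.ofReal (u t x))
          atTop := lintegral_liminf_le fun n => (measurable_weight _).mul hmeas
    _ ≤ _ := by
        refine liminf_le_of_frequently_le' (Eventually.frequently ?_)
        filter_upwards [hlim.eventually hev] with n hn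
        have hpos : (0:ℝ) < 1 / ((n : ℝ) + 1) := by positivity
        refine (hu.weighted_mass_le_two_mul hJ h0 hM (measurable_weight _)
          (fun x z hz => weight_add_le hpos.le hn x z (hρ z hz))
          (lintegral_weight_ne_top hpos.ne') hs ht).trans ?_
        gcongr with x
        exact mul_le_of_le_one_left zero_le (weight_le_one _ _)

/-- The mass of a bounded nonnegative flow with integrable initial datum is locally bounded. -/
lemma IsFlow.exists_mass_bound {J μ : RN N → ℝ} (hJ : IsKernel J) {u : ℝ → RN N →ᵇ ℝ}
    (hu : IsFlow J μ u) (h0 : ∀ t, 0 ≤ t → ∀ x, 0 ≤ u t x) {M : ℝ}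
    (hM : ∀ t, 0 ≤ t → ∀ x, u t x ≤ M) (hi : Integrable (u 0)) (T : ℝ) :
    ∃ K : ℝ≥0∞, K ≠ ∞ ∧ ∀ t ∈ Icc 0 T, ∫⁻ x, ENNReal.ofReal (u t x) ≤ K := by
  have hstep : ∀ n : ℕ, ∀ t ∈ Icc (0:ℝ) (n * (1 / 5)),
      ∫⁻ x, ENNReal.ofReal (u t x) ≤ 2 ^ n * ∫⁻ x, ENNReal.ofReal (u 0 x) := by
    intro n
    induction n with
    | zero =>
      intro t ht
      have : t = 0 := le_antisymm (by simpa using ht.2) ht.1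
      simp [this]
    | succ n ih =>
      intro t ht
      rcases le_total t (n * (1 / 5)) with h | h
      · refine (ih t ⟨ht.1, h⟩).trans ?_
        gcongr <;> norm_num
      · have h1 := hu.mass_le_two_mul hJ h0 hM (s := n * (1 / 5)) (t := t) (by positivity)
          ⟨h, by have := ht.2; push_cast at this; linarith⟩
        refine h1.trans ?_
        rw [pow_succ, mul_comm (2 ^ n), mul_assoc]
        gcongr
        exact ih _ ⟨by positivity, le_rfl⟩
  obtain ⟨n, hn⟩ := exists_nat_ge (5 * T)
  refine ⟨2 ^ n * ∫⁻ x, ENNReal.ofReal (u 0 x),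
    ENNReal.mul_ne_top (by simp) hi.lintegral_lt_top.ne, fun t ht => hstep n t ⟨ht.1, ?_⟩⟩
  linarith [ht.2]

lemma IsFlow.integrable {J μ : RN N → ℝ} (hJ : IsKernel J) {u : ℝ → RN N →ᵇ ℝ}
    (hu : IsFlow J μ u) (h0 : ∀ t, 0 ≤ t → ∀ x, 0 ≤ u t x) {M : ℝ}
    (hM : ∀ t, 0 ≤ t → ∀ x, u t x ≤ M) (hi : Integrable (u 0)) {t : ℝ} (ht : 0 ≤ t) :
    Integrable (u t) := by
  obtain ⟨K, hK, h⟩ := hu.exists_mass_bound hJ h0 hM hi t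
  refine ⟨(u t).continuous.aestronglyMeasurable, ?_⟩
  rw [hasFiniteIntegral_iff_ofReal (.of_forall (h0 t ht))]
  exact (h t ⟨ht, le_rfl⟩).trans_lt hK.lt_top

/-! ### Translation energies and the nonlocal Nash inequality. -/

/-- The squared `L²` distance of a function to its translate. -/
noncomputable def shiftEnergy (v : RN N → ℝ) (z : RN N) : ℝ := ∫ x, (v (x - z) - v x) ^ 2

/-- The nonlocal Dirichlet energy of a function. -/
noncomputable def energy (J v : RN N → ℝ) : ℝ := ∫ z, J z * shiftEnergy v z

lemma shiftEnergy_nonneg (v : RN N → ℝ) (z : RN N) : 0 ≤ shiftEnergy v z :=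
  integral_nonneg fun _ => sq_nonneg _

lemma energy_nonneg {J : RN N → ℝ} (hJ : IsKernel J) (v : RN N → ℝ) : 0 ≤ energy J v :=
  integral_nonneg fun z => mul_nonneg (hJ.nonneg z) (shiftEnergy_nonneg v z)

lemma memLp_shift {v : RN N → ℝ} (hv : MemLp v 2) (z : RN N) : MemLp (fun x => v (x - z)) 2 :=
  hv.comp_measurePreserving (measurePreserving_sub_right volume z)

lemma integrable_shift_sub_sq {v : RN N → ℝ} (hv : MemLp v 2) (y z : RN N) :
    Integrable fun x => (v (x - y) - v (x - z)) ^ 2 :=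
  ((memLp_shift hv y).sub (memLp_shift hv z)).integrable_sq

lemma integrable_shift_sub_self_sq {v : RN N → ℝ} (hv : MemLp v 2) (z : RN N) :
    Integrable fun x => (v (x - z) - v x) ^ 2 :=
  ((memLp_shift hv z).sub hv).integrable_sq

lemma integral_shift_sub_sq (v : RN N → ℝ) (w h : RN N) :
    ∫ x, (v (x - (w + h)) - v (x - w)) ^ 2 = shiftEnergy v h := by
  unfold shiftEnergy
  rw [← integral_sub_right_eq_self (fun x => (v (x - h) - v x) ^ 2) w]
  simp only [sub_sub]

lemma shiftEnergy_le {v : RN N → ℝ} (hv : MemLp v 2) (w h : RN N) :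
    shiftEnergy v h ≤ 2 * shiftEnergy v (w + h) + 2 * shiftEnergy v w := by
  rw [← integral_shift_sub_sq v w h]
  unfold shiftEnergy
  rw [← integral_const_mul, ← integral_const_mul,
    ← integral_add ((integrable_shift_sub_self_sq hv _).const_mul 2)
      ((integrable_shift_sub_self_sq hv _).const_mul 2)]
  refine integral_mono (integrable_shift_sub_sq hv _ _)
    (((integrable_shift_sub_self_sq hv _).const_mul 2).add
      ((integrable_shift_sub_self_sq hv _).const_mul 2)) fun x => ?_
  simp only
  nlinarith [sq_nonneg (v (x - (w + h)) - v x + (v (x - w) - v x))]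

/-- Telescoping into k equal translations and Cauchy–Schwarz. The factor k² is the source of the r²
in the Nash inequality. -/
lemma shiftEnergy_nsmul_le {v : RN N → ℝ} (hv : MemLp v 2) (k : ℕ) (h : RN N) :
    shiftEnergy v (k • h) ≤ (k : ℝ) ^ 2 * shiftEnergy v h := by
  calc shiftEnergy v (k • h)
      ≤ ∫ x, (k : ℝ) * ∑ i ∈ Finset.range k, (v (x - (i + 1) • h) - v (x - i • h)) ^ 2 := by
        refine integral_mono (integrable_shift_sub_self_sq hv _)
          ((integrable_finsetSum _ fun i _ => integrable_shift_sub_sq hv _ _).const_mul _)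
          fun x => ?_
        have h1 := Finset.sum_range_sub (fun i : ℕ => v (x - i • h)) k
        simp only [zero_smul, sub_zero] at h1
        simp only
        rw [← h1]
        have := sq_sum_le_card_mul_sum_sq (s := Finset.range k)
          (f := fun i : ℕ => v (x - (i + 1) • h) - v (x - i • h))
        rwa [Finset.card_range] at this
    _ = (k : ℝ) * ∑ i ∈ Finset.range k, shiftEnergy v h := by
        rw [integral_const_mul, integral_finsetSum _ fun i _ => integrable_shift_sub_sq hv _ _]
        congr 1
        refine Finset.sum_congr rfl fun i _ => ?_
        rw [← integral_shift_sub_sq v (i • h) h]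
        simp only [add_smul, one_smul]
    _ = _ := by
        rw [Finset.sum_const, Finset.card_range, nsmul_eq_mul]
        ring

lemma integral_shift_sq (v : RN N → ℝ) (z : RN N) : ∫ x, v (x - z) ^ 2 = ∫ x, v x ^ 2 :=
  integral_sub_right_eq_self (fun x => v x ^ 2) z

lemma shiftEnergy_eq {v : RN N → ℝ} (hv : MemLp v 2) (z : RN N) :
    shiftEnergy v z = 2 * (∫ x, v x ^ 2) - 2 * ∫ x, v (x - z) * v x := by
  have h1 := (memLp_shift hv z).integrable_sq
  have h2 := hv.integrable_sq
  have h3 : Integrable fun x => v (x - z) * v x := (memLp_shift hv z).integrable_mul hv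
  calc shiftEnergy v z = ∫ x, (v (x - z) ^ 2 + v x ^ 2 - 2 * (v (x - z) * v x)) := by
        unfold shiftEnergy
        congr 1 with x
        ring
    _ = _ := by
        rw [integral_sub (by exact h1.add h2) (h3.const_mul 2), integral_add h1 h2, integral_const_mul,
          integral_shift_sq]
        ring

lemma shiftEnergy_le_four_mul {v : RN N → ℝ} (hv : MemLp v 2) (z : RN N) :
    shiftEnergy v z ≤ 4 * ∫ x, v x ^ 2 := by
  have h1 := (memLp_shift hv z).integrable_sq
  have h2 := hv.integrable_sq
  calc shiftEnergy v z ≤ ∫ x, (2 * v (x - z) ^ 2 + 2 * v x ^ 2) := by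
        refine integral_mono (integrable_shift_sub_self_sq hv _)
          ((h1.const_mul 2).add (h2.const_mul 2)) fun x => ?_
        simp only
        nlinarith [sq_nonneg (v (x - z) + v x)]
    _ = _ := by
        rw [integral_add (h1.const_mul 2) (h2.const_mul 2), integral_const_mul,
          integral_const_mul, integral_shift_sq]
        ring

lemma stronglyMeasurable_shiftEnergy {v : RN N → ℝ} (hc : Continuous v) :
    StronglyMeasurable (shiftEnergy v) := by
  have : StronglyMeasurable fun p : RN N × RN N => (v (p.2 - p.1) - v p.2) ^ 2 :=
    Continuous.stronglyMeasurable (by fun_prop)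
  exact this.integral_prod_right'

lemma IsKernel.integrable_mul_shiftEnergy {J v : RN N → ℝ} (hJ : IsKernel J) (hc : Continuous v)
    (hv : MemLp v 2) : Integrable fun z => J z * shiftEnergy v z :=
  hJ.integrable.mul_bdd (c := 4 * ∫ x, v x ^ 2)
    (stronglyMeasurable_shiftEnergy hc).aestronglyMeasurable
    (.of_forall fun z => by
      rw [Real.norm_of_nonneg (shiftEnergy_nonneg v z)]
      exact shiftEnergy_le_four_mul hv z)

lemma IsKernel.exists_ball {J : RN N → ℝ} (hJ : IsKernel J) :
    ∃ z₀ : RN N, ∃ c > 0, ∃ δ > 0, ∀ z ∈ Metric.ball z₀ (2 * δ), c ≤ J z := by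
  have : ∃ z₀, 0 < J z₀ := by
    by_contra! h
    have h1 : J = 0 := funext fun z => le_antisymm (h z) (hJ.nonneg z)
    have h2 := hJ.integral_eq_one
    simp [h1] at h2
  obtain ⟨z₀, hz₀⟩ := this
  have h1 : ∀ᶠ z in nhds z₀, J z₀ / 2 < J z :=
    hJ.continuous.continuousAt.eventually (lt_mem_nhds (half_lt_self hz₀))
  obtain ⟨ε, hε, h2⟩ := Metric.eventually_nhds_iff_ball.1 h1
  refine ⟨z₀, J z₀ / 2, half_pos hz₀, ε / 2, half_pos hε, fun z hz => (h2 z ?_).le⟩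
  rwa [mul_div_cancel₀ _ two_ne_zero] at hz

/-- Small translations are controlled by the energy. -/
lemma IsKernel.exists_shiftEnergy_le_of_small {J : RN N → ℝ} (hJ : IsKernel J) :
    ∃ C > 0, ∃ δ > 0, ∀ v : RN N → ℝ, Continuous v → MemLp v 2 → ∀ h : RN N, ‖h‖ < δ →
      shiftEnergy v h ≤ C * energy J v := by
  obtain ⟨z₀, c, hc, δ, hδ, hJc⟩ := hJ.exists_ball
  set V : ℝ := volume.real (Metric.ball z₀ δ)
  have hV : 0 < V :=
    ENNReal.toReal_pos (Metric.measure_ball_pos volume z₀ hδ).ne' measure_ball_lt_top.ne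
  refine ⟨4 / (c * V), by positivity, δ, hδ, fun v hvc hv h hh => ?_⟩
  have hintg := hJ.integrable_mul_shiftEnergy hvc hv
  have hnn : ∀ z, 0 ≤ J z * shiftEnergy v z := fun z =>
    mul_nonneg (hJ.nonneg z) (shiftEnergy_nonneg v z)
  -- A translation by h is a translation by w + h undone by one by w. Averaging over w in the ball
  -- keeps both w and w + h where J ≥ c; the two bounds, for k = h and k = 0, add up to the constant
  -- 4/(cV).
  have key : ∀ k : RN N, ‖k‖ < δ →
      IntegrableOn (fun w => shiftEnergy v (w + k)) (Metric.ball z₀ δ) ∧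
      c * ∫ w in Metric.ball z₀ δ, shiftEnergy v (w + k) ≤ energy J v := by
    intro k hk
    have h1 : IntegrableOn (fun w => shiftEnergy v (w + k)) (Metric.ball z₀ δ) :=
      Measure.integrableOn_of_bounded measure_ball_lt_top.ne
        ((stronglyMeasurable_shiftEnergy hvc).comp_measurable
          (by fun_prop)).aestronglyMeasurable
        (.of_forall fun z => by
          rw [Real.norm_of_nonneg (shiftEnergy_nonneg v _)]
          exact shiftEnergy_le_four_mul hv _)
    refine ⟨h1, ?_⟩
    have h2 := hintg.comp_add_right k
    calc c * ∫ w in Metric.ball z₀ δ, shiftEnergy v (w + k)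
        = ∫ w in Metric.ball z₀ δ, c * shiftEnergy v (w + k) := (integral_const_mul _ _).symm
      _ ≤ ∫ w in Metric.ball z₀ δ, J (w + k) * shiftEnergy v (w + k) := by
          refine setIntegral_mono_on (h1.const_mul c) h2.integrableOn measurableSet_ball
            fun w hw => mul_le_mul_of_nonneg_right (hJc _ ?_) (shiftEnergy_nonneg v _)
          rw [mem_ball_iff_norm] at hw ⊢
          calc ‖w + k - z₀‖ = ‖(w - z₀) + k‖ := by congr 1; abel
            _ ≤ ‖w - z₀‖ + ‖k‖ := norm_add_le _ _
            _ < 2 * δ := by linarith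
      _ ≤ ∫ w, J (w + k) * shiftEnergy v (w + k) :=
          setIntegral_le_integral h2 (.of_forall fun w => hnn (w + k))
      _ = energy J v := integral_add_right_eq_self (fun w => J w * shiftEnergy v w) k
  obtain ⟨i1, k1⟩ := key h hh
  obtain ⟨i0, k0⟩ := key 0 (by simpa using hδ)
  simp only [add_zero] at i0 k0
  have h3 : V * shiftEnergy v h ≤ 2 * (∫ w in Metric.ball z₀ δ, shiftEnergy v (w + h)) +
      2 * ∫ w in Metric.ball z₀ δ, shiftEnergy v w := by
    calc V * shiftEnergy v h = ∫ w in Metric.ball z₀ δ, shiftEnergy v h := by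
          rw [setIntegral_const, smul_eq_mul]
      _ ≤ ∫ w in Metric.ball z₀ δ, (2 * shiftEnergy v (w + h) + 2 * shiftEnergy v w) :=
          integral_mono (integrableOn_const measure_ball_lt_top.ne) ((i1.const_mul 2).add (i0.const_mul 2))
            fun w => shiftEnergy_le hv w h
      _ = _ := by
          rw [integral_add (i1.const_mul 2) (i0.const_mul 2), integral_const_mul,
            integral_const_mul]
  rw [div_mul_eq_mul_div, le_div_iff₀ (by positivity)]
  nlinarith

/-- Translations are controlled by the energy, with quadratic growth. -/
lemma IsKernel.exists_shiftEnergy_le {J : RN N → ℝ} (hJ : IsKernel J) :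
    ∃ C > 0, ∀ v : RN N → ℝ, Continuous v → MemLp v 2 → ∀ r : ℝ, 1 ≤ r → ∀ h : RN N, ‖h‖ < r →
      shiftEnergy v h ≤ C * r ^ 2 * energy J v := by
  obtain ⟨C, hC, δ, hδ, hsmall⟩ := hJ.exists_shiftEnergy_le_of_small
  refine ⟨C * (1 / δ + 1) ^ 2, by positivity, fun v hvc hv r hr h hh => ?_⟩
  have hr0 : 0 < r := by linarith
  -- Enough steps for each one to be shorter than δ; r ≥ 1 absorbs the rounding into a multiple of
  -- r.
  set k : ℕ := ⌈r / δ⌉₊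
  have hk0 : 0 < k := Nat.ceil_pos.2 (by positivity)
  have hk0' : (0:ℝ) < k := by exact_mod_cast hk0
  have hk1 : r / δ ≤ k := Nat.le_ceil _
  have hk2 : (k : ℝ) ≤ (1 / δ + 1) * r := by
    have := (Nat.ceil_lt_add_one (by positivity : 0 ≤ r / δ)).le
    calc (k : ℝ) ≤ r / δ + 1 := this
      _ ≤ r / δ + r := by gcongr
      _ = _ := by ring
  have hdecomp : h = k • ((k : ℝ)⁻¹ • h) := by
    rw [← Nat.cast_smul_eq_nsmul ℝ, smul_smul, mul_inv_cancel₀ hk0'.ne', one_smul]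
  have hE := energy_nonneg hJ v
  have hs : ‖(k : ℝ)⁻¹ • h‖ < δ := by
    rw [norm_smul, norm_inv, Real.norm_of_nonneg hk0'.le, inv_mul_lt_iff₀ hk0']
    rw [div_le_iff₀ hδ] at hk1
    linarith
  calc shiftEnergy v h = shiftEnergy v (k • ((k : ℝ)⁻¹ • h)) := by rw [← hdecomp]
    _ ≤ (k : ℝ) ^ 2 * shiftEnergy v ((k : ℝ)⁻¹ • h) := shiftEnergy_nsmul_le hv _ _
    _ ≤ ((1 / δ + 1) * r) ^ 2 * (C * energy J v) := by
        gcongr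
        · exact shiftEnergy_nonneg v _
        · exact hsmall v hvc hv _ hs
    _ = _ := by ring

/-- The autocorrelation is the convolution of v with its reflection, so Fubini applies. -/
lemma integral_autocorrelation {v : RN N → ℝ} (hi : Integrable v) :
    Integrable (fun h => ∫ x, v (x - h) * v x) ∧
      ∫ h, ∫ x, v (x - h) * v x = (∫ x, v x) ^ 2 := by
  have hintg : Integrable (fun p : RN N × RN N => v (-p.2) * v (p.1 - p.2)) :=
    (hi.comp_neg).convolution_integrand (ContinuousLinearMap.mul ℝ ℝ) hi
  have heq : ∀ h, ∫ x, v (x - h) * v x = ∫ t, v (-t) * v (h - t) := by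
    intro h
    rw [← integral_add_right_eq_self _ h, ← integral_neg_eq_self]
    refine integral_congr_ae (.of_forall fun t => ?_)
    simp only [neg_add_eq_sub, sub_sub_cancel_left]
  simp_rw [heq]
  refine ⟨hintg.integral_prod_left, ?_⟩
  rw [integral_integral_swap hintg]
  have : ∀ t, ∫ h, v (-t) * v (h - t) = v (-t) * ∫ x, v x := fun t => by
    rw [integral_const_mul, integral_sub_right_eq_self v t]
  simp_rw [this]
  rw [integral_mul_const, integral_neg_eq_self v, sq]

/-- A nonlocal Nash inequality at scale `r`. -/
theorem IsKernel.exists_nash {J : RN N → ℝ} (hJ : IsKernel J) :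
    ∃ C > 0, ∀ v : RN N → ℝ, Continuous v → (∀ x, 0 ≤ v x) → Integrable v → MemLp v 2 →
      ∀ r : ℝ, 1 ≤ r →
        ∫ x, v x ^ 2 ≤ C * (∫ x, v x) ^ 2 / r ^ N + C * r ^ 2 * energy J v := by
  obtain ⟨C, hC, hshift⟩ := hJ.exists_shiftEnergy_le
  set ω : ℝ := volume.real (Metric.ball (0 : RN N) 1)
  have hω : 0 < ω :=
    ENNReal.toReal_pos (Metric.measure_ball_pos volume _ one_pos).ne' measure_ball_lt_top.ne
  refine ⟨1 / ω + C, by positivity, fun v hvc hv0 hi hv r hr => ?_⟩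
  have hr0 : 0 < r := by linarith
  have hvol : volume.real (Metric.ball (0 : RN N) r) = r ^ N * ω := by
    rw [Measure.real, Measure.addHaar_ball_of_pos _ _ hr0, finrank_euclideanSpace_fin,
      ENNReal.toReal_mul, ENNReal.toReal_ofReal (by positivity)]
    rfl
  obtain ⟨ha, ha'⟩ := integral_autocorrelation hi
  -- Average over |h| < r the identity ∫v² = ∫v(x - h)v(x) dx + (translation energy)/2. As v ≥ 0,
  -- the autocorrelation over the ball is at most its full integral (∫v)².
  have h1 : r ^ N * ω * ∫ x, v x ^ 2 ≤ (∫ x, v x) ^ 2 +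
      r ^ N * ω * (C * r ^ 2 * energy J v / 2) := by
    calc r ^ N * ω * ∫ x, v x ^ 2
        = ∫ h in Metric.ball (0 : RN N) r, ∫ x, v x ^ 2 := by
          rw [setIntegral_const, smul_eq_mul, hvol]
      _ ≤ ∫ h in Metric.ball (0 : RN N) r,
            ((∫ x, v (x - h) * v x) + C * r ^ 2 * energy J v / 2) := by
          refine setIntegral_mono_on (integrableOn_const measure_ball_lt_top.ne)
            (ha.integrableOn.add (integrableOn_const measure_ball_lt_top.ne)) measurableSet_ball fun h hh => ?_
          have h2 := hshift v hvc hv r hr h (by simpa using hh)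
          rw [shiftEnergy_eq hv] at h2
          linarith
      _ = (∫ h in Metric.ball (0 : RN N) r, ∫ x, v (x - h) * v x) +
            r ^ N * ω * (C * r ^ 2 * energy J v / 2) := by
          rw [integral_add ha.integrableOn (integrableOn_const measure_ball_lt_top.ne), setIntegral_const, smul_eq_mul,
            hvol]
      _ ≤ _ := by
          rw [← ha']
          refine add_le_add_left (setIntegral_le_integral ha ?_) _
          exact (.of_forall fun h => integral_nonneg fun x => mul_nonneg (hv0 _) (hv0 _))
  have hE := energy_nonneg hJ v
  calc ∫ x, v x ^ 2 ≤ ((∫ x, v x) ^ 2 + r ^ N * ω * (C * r ^ 2 * energy J v / 2)) /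
        (r ^ N * ω) := by rwa [le_div_iff₀' (by positivity)]
    _ = 1 / ω * (∫ x, v x) ^ 2 / r ^ N + C / 2 * r ^ 2 * energy J v := by field_simp
    _ ≤ _ := by
      have : C / 2 ≤ 1 / ω + C := by linarith [one_div_pos.2 hω]
      have : 1 / ω ≤ 1 / ω + C := by linarith
      gcongr

/-! ### Entropy dissipation and the global mass bound. -/

lemma phi_le_add_sq {μ m s : ℝ} (h0 : 0 ≤ μ) (hm : μ ≤ m) : phi μ s ≤ s + m / 2 * s ^ 2 := by
  have h1 : phi μ s = s + μ / 2 * s ^ 2 / (1 + μ ^ 2 * s ^ 2) := by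
    unfold phi
    field_simp
  have h2 : μ / 2 * s ^ 2 / (1 + μ ^ 2 * s ^ 2) ≤ μ / 2 * s ^ 2 :=
    div_le_self (by positivity) (by nlinarith [mul_nonneg (sq_nonneg μ) (sq_nonneg s)])
  rw [h1]
  nlinarith [sq_nonneg s]

/-- The pointwise inequality behind the entropy estimates. -/
lemma mul_phi_le {α β e m M μ a b : ℝ} (hα : 0 ≤ α) (hβ : 0 ≤ β)
    (he : α * m / 2 + e ≤ β * (1 - M * m)) (h0 : 0 ≤ μ) (hm : μ ≤ m) (hb : 0 ≤ b) (hbM : b ≤ M) :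
    (α + 2 * β * b) * phi μ (a - b) ≤
      α * (a - b) + β * (a ^ 2 - b ^ 2) - e * (a - b) ^ 2 := by
  have h1 := mul_le_mul_of_nonneg_left (phi_le_add_sq (s := a - b) h0 hm)
    (by positivity : 0 ≤ α + 2 * β * b)
  refine h1.trans ?_
  have hm0 : 0 ≤ m := h0.trans hm
  -- Here b ≤ M turns the cubic error into a quadratic one, to be absorbed by -β(a - b)².
  have h2 : β * b * m * (a - b) ^ 2 ≤ β * M * m * (a - b) ^ 2 := by gcongr
  have h3 := mul_le_mul_of_nonneg_right he (sq_nonneg (a - b))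
  linarith

lemma memLp_two_of_bounded {v : RN N → ℝ} {M : ℝ} (hc : Continuous v) (h0 : ∀ x, 0 ≤ v x)
    (hM : ∀ x, v x ≤ M) (hi : Integrable v) : MemLp v 2 := by
  rw [memLp_two_iff_integrable_sq hc.aestronglyMeasurable]
  simp_rw [sq]
  exact hi.mul_bdd (c := M) hc.aestronglyMeasurable
    (.of_forall fun x => by rw [Real.norm_of_nonneg (h0 x)]; exact hM x)

lemma IsKernel.integrable_prod {J v : RN N → ℝ} (hJ : IsKernel J) (hi : Integrable v) :
    Integrable fun p : RN N × RN N => J p.2 * (v (p.1 - p.2) + v p.1) := by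
  have h1 : Integrable fun p : RN N × RN N => J p.2 * v (p.1 - p.2) :=
    hJ.integrable.convolution_integrand (ContinuousLinearMap.mul ℝ ℝ) hi
  have h2 : Integrable fun p : RN N × RN N => v p.1 * J p.2 := hi.mul_prod hJ.integrable
  refine (h1.add h2).congr (.of_forall fun p => ?_)
  simp only [Pi.add_apply]
  ring

lemma integral_shift_add {J v : RN N → ℝ} (hJ : IsKernel J) (hi : Integrable v) :
    ∫ x, ∫ z, J z * (v (x - z) + v x) = 2 * ∫ x, v x := by
  rw [integral_integral_swap (hJ.integrable_prod hi)]
  have : ∀ z, ∫ x, J z * (v (x - z) + v x) = J z * (2 * ∫ x, v x) := fun z => by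
    rw [integral_const_mul, integral_add (hi.comp_sub_right z) hi, integral_sub_right_eq_self v z]
    ring
  simp_rw [this]
  exact hJ.integral_mul_right _

lemma abs_flux_le {J v : RN N → ℝ} (hJ : IsKernel J) (hc : Continuous v) (h0 : ∀ x, 0 ≤ v x)
    (m : ℝ) (x : RN N) : |flux J v m x| ≤ 5 / 4 * ∫ z, J z * (v (x - z) + v x) := by
  rw [← integral_const_mul, ← Real.norm_eq_abs, flux]
  refine norm_integral_le_of_norm_le
    ((hJ.integrable_mul (by fun_prop : Continuous fun z => v (x - z) + v x)).const_mul _)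
    (.of_forall fun z => ?_)
  rw [Real.norm_eq_abs, abs_mul, abs_of_nonneg (hJ.nonneg z)]
  calc J z * |phi m (v (x - z) - v x)| ≤ J z * (5 / 4 * (v (x - z) + v x)) := by
        refine mul_le_mul_of_nonneg_left ((abs_phi_le _ _).trans ?_) (hJ.nonneg z)
        gcongr
        rw [abs_le]
        constructor <;> linarith [h0 x, h0 (x - z)]
    _ = _ := by ring

lemma aestronglyMeasurable_flux {J μ : RN N → ℝ} (hJ : IsKernel J)
    (hμ : AEStronglyMeasurable μ volume) (v : RN N →ᵇ ℝ) :
    AEStronglyMeasurable (fun x : RN N => flux J v (μ x) x) volume := by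
  have hc : Continuous fun q : ℝ × RN N => flux J v q.1 q.2 :=
    (hJ.continuous_flux (u := fun _ => v) continuous_const).comp
      (by fun_prop : Continuous fun q : ℝ × RN N => ((0:ℝ), q))
  have hm : AEStronglyMeasurable (fun x => (μ x, x)) volume :=
    hμ.prodMk continuous_id.aestronglyMeasurable
  have := hc.comp_aestronglyMeasurable hm
  exact this

/-- The `L¹` bound on the entropy production. -/
lemma integrable_mul_flux {J μ : RN N → ℝ} (hJ : IsKernel J)
    (hμ : AEStronglyMeasurable μ volume) {v : RN N →ᵇ ℝ} {M α β : ℝ} (h0 : ∀ x, 0 ≤ v x)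
    (hM : ∀ x, v x ≤ M) (hi : Integrable v) (hα : 0 ≤ α) (hβ : 0 ≤ β) :
    Integrable (fun x => (α + 2 * β * v x) * flux J v (μ x) x) ∧
      ∫ x, ‖(α + 2 * β * v x) * flux J v (μ x) x‖ ≤
        (α + 2 * β * M) * (5 / 4) * (2 * ∫ x, v x) := by
  have hdom : Integrable fun x => (α + 2 * β * M) * (5 / 4) * ∫ z, J z * (v (x - z) + v x) :=
    (hJ.integrable_prod hi).integral_prod_left.const_mul _
  have hle : ∀ x, ‖(α + 2 * β * v x) * flux J v (μ x) x‖ ≤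
      (α + 2 * β * M) * (5 / 4) * ∫ z, J z * (v (x - z) + v x) := fun x => by
    have h1 := h0 x
    have h2 := hM x
    have h3 : 0 ≤ α + 2 * β * v x := by positivity
    have hM0 : 0 ≤ M := h1.trans h2
    rw [norm_mul, Real.norm_of_nonneg h3, Real.norm_eq_abs, mul_assoc (α + 2 * β * M)]
    have := abs_flux_le hJ v.continuous h0 (μ x) x
    gcongr
  have hintg : Integrable (fun x => (α + 2 * β * v x) * flux J v (μ x) x) := by
    refine hdom.mono' (AEStronglyMeasurable.mul ?_ (aestronglyMeasurable_flux hJ hμ v))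
      (.of_forall hle)
    exact Continuous.aestronglyMeasurable (by fun_prop)
  refine ⟨hintg, ?_⟩
  calc _ ≤ ∫ x, (α + 2 * β * M) * (5 / 4) * ∫ z, J z * (v (x - z) + v x) :=
        integral_mono hintg.norm hdom hle
    _ = _ := by rw [integral_const_mul, integral_shift_add hJ hi]

/-- The entropy production inequality. -/
lemma integral_mul_flux_le {J μ : RN N → ℝ} (hJ : IsKernel J)
    (hμ : AEStronglyMeasurable μ volume) {m : ℝ} (hμ0 : ∀ᵐ x, 0 ≤ μ x) (hμm : ∀ᵐ x, μ x ≤ m)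
    {v : RN N →ᵇ ℝ} {M α β e : ℝ} (h0 : ∀ x, 0 ≤ v x)
    (hM : ∀ x, v x ≤ M) (hi : Integrable v) (hα : 0 ≤ α) (hβ : 0 ≤ β) (he0 : 0 ≤ e)
    (he : α * m / 2 + e ≤ β * (1 - M * m)) :
    ∫ x, (α + 2 * β * v x) * flux J v (μ x) x ≤ -(e * energy J v) := by
  have hv2 : MemLp v 2 := memLp_two_of_bounded v.continuous h0 hM hi
  have hM0 : 0 ≤ M := (h0 0).trans (hM 0)
  set K : RN N → RN N → ℝ := fun x z => J z * (α * (v (x - z) - v x) +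
    β * (v (x - z) ^ 2 - v x ^ 2) - e * (v (x - z) - v x) ^ 2) with hK
  have hKint : Integrable (Function.uncurry K) := by
    refine ((hJ.integrable_prod hi).const_mul (α + β * M + e * M)).mono' ?_
      (.of_forall fun p => ?_)
    · have := hJ.continuous
      exact Continuous.aestronglyMeasurable (by unfold K Function.uncurry; fun_prop)
    · simp only [Function.uncurry, hK]
      rw [norm_mul, Real.norm_of_nonneg (hJ.nonneg _)]
      have ha := h0 (p.1 - p.2)
      have hb := h0 p.1
      have haM := hM (p.1 - p.2)
      have hbM := hM p.1
      generalize v (p.1 - p.2) = a at *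
      generalize v p.1 = b at *
      have i1 : |α * (a - b)| ≤ α * (a + b) := by
        rw [abs_mul, abs_of_nonneg hα]
        gcongr
        rw [abs_le]; constructor <;> linarith
      have i2 : |β * (a ^ 2 - b ^ 2)| ≤ β * (M * (a + b)) := by
        rw [abs_mul, abs_of_nonneg hβ]
        gcongr
        rw [abs_le]; constructor <;> nlinarith
      have i3 : |e * (a - b) ^ 2| ≤ e * (M * (a + b)) := by
        rw [abs_mul, abs_of_nonneg he0, abs_of_nonneg (sq_nonneg _)]
        gcongr
        nlinarith
      calc J p.2 * ‖α * (a - b) + β * (a ^ 2 - b ^ 2) - e * (a - b) ^ 2‖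
          ≤ J p.2 * (α * (a + b) + β * (M * (a + b)) + e * (M * (a + b))) := by
            refine mul_le_mul_of_nonneg_left ?_ (hJ.nonneg _)
            refine (abs_sub _ _).trans (add_le_add ((abs_add_le _ _).trans ?_) i3)
            exact add_le_add i1 i2
        _ = _ := by ring
  calc ∫ x, (α + 2 * β * v x) * flux J v (μ x) x
      ≤ ∫ x, ∫ z, K x z := by
        refine integral_mono_ae (integrable_mul_flux hJ hμ h0 hM hi hα hβ).1
          hKint.integral_prod_left ?_
        filter_upwards [hμ0, hμm] with x hx0 hxm
        unfold flux
        rw [← integral_const_mul]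
        refine integral_mono ((hJ.integrable_flux v.continuous _ _).const_mul _)
          (hJ.integrable_mul (by fun_prop)) fun z => ?_
        have := mul_le_mul_of_nonneg_left
          (mul_phi_le (a := v (x - z)) hα hβ he hx0 hxm (h0 x) (hM x)) (hJ.nonneg z)
        simp only
        linarith
    _ = ∫ z, ∫ x, K x z := integral_integral_swap hKint
    -- For fixed z the linear terms and the differences of squares integrate to zero in x by
    -- translation invariance; only the energy survives.
    _ = ∫ z, -(e * (J z * shiftEnergy v z)) := by
        congr 1 with z
        have s1 : Integrable fun x => v (x - z) := hi.comp_sub_right z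
        have s2 := (memLp_shift hv2 z).integrable_sq
        have s3 := hv2.integrable_sq
        have s4 := integrable_shift_sub_self_sq hv2 z
        have t1 : Integrable fun x => α * (v (x - z) - v x) := (s1.sub hi).const_mul α
        have t2 : Integrable fun x => β * (v (x - z) ^ 2 - v x ^ 2) := (s2.sub s3).const_mul β
        rw [hK]
        simp only
        rw [integral_const_mul, integral_sub (by exact t1.add t2) (s4.const_mul e),
          integral_add t1 t2, integral_const_mul, integral_const_mul, integral_const_mul,
          integral_sub s1 hi, integral_sub s2 s3, integral_shift_sq,
          integral_sub_right_eq_self v z]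
        unfold shiftEnergy
        ring
    _ = _ := by rw [integral_neg, integral_const_mul, energy]

lemma integrable_entropy {v : RN N → ℝ} {M : ℝ} (hc : Continuous v) (h0 : ∀ x, 0 ≤ v x)
    (hM : ∀ x, v x ≤ M) (hi : Integrable v) (α β : ℝ) :
    Integrable fun x => α * v x + β * v x ^ 2 :=
  (hi.const_mul α).add ((memLp_two_of_bounded hc h0 hM hi).integrable_sq.const_mul β)

/-- Justifies exchanging the time and space integrals in `IsFlow.entropy_le`; the mass bound uniform
on the time interval supplies the domination. -/
lemma IsFlow.integrable_entropy_production {J μ : RN N → ℝ} (hJ : IsKernel J)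
    (hμ : AEStronglyMeasurable μ volume) {u : ℝ → RN N →ᵇ ℝ} (hu : IsFlow J μ u)
    {M α β : ℝ} (h0 : ∀ t, 0 ≤ t → ∀ x, 0 ≤ u t x)
    (hM : ∀ t, 0 ≤ t → ∀ x, u t x ≤ M) (hi : Integrable (u 0)) (hα : 0 ≤ α) (hβ : 0 ≤ β)
    {s : ℝ} (hs : 0 ≤ s) (t : ℝ) :
    Integrable (fun p : RN N × ℝ => (α + 2 * β * u p.2 p.1) * flux J (u p.2) (μ p.1) p.1)
      (volume.prod (volume.restrict (Ioc s t))) := by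
  obtain ⟨K, hK, hmass⟩ := hu.exists_mass_bound hJ h0 hM hi t
  have hM0 : 0 ≤ M := (h0 0 le_rfl 0).trans (hM 0 le_rfl 0)
  have hmeas : AEStronglyMeasurable
      (fun p : RN N × ℝ => (α + 2 * β * u p.2 p.1) * flux J (u p.2) (μ p.1) p.1)
      (volume.prod (volume.restrict (Ioc s t))) := by
    have hue : Continuous fun p : RN N × ℝ => u p.2 p.1 :=
      continuous_eval_of_continuous hu.continuous continuous_snd continuous_fst
    have hm : AEStronglyMeasurable (fun p : RN N × ℝ => (p.2, μ p.1, p.1))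
        (volume.prod (volume.restrict (Ioc s t))) :=
      continuous_snd.aestronglyMeasurable.prodMk
        (hμ.comp_fst.prodMk continuous_fst.aestronglyMeasurable)
    exact (continuous_const.add (continuous_const.mul hue)).aestronglyMeasurable.mul
      ((hJ.continuous_flux hu.continuous).comp_aestronglyMeasurable hm)
  have hb : ∀ τ ∈ Ioc s t, Integrable (u τ) ∧ ∫ x, u τ x ≤ K.toReal := fun τ hτ => by
    have hτ0 : 0 ≤ τ := hs.trans hτ.1.le
    refine ⟨hu.integrable hJ h0 hM hi hτ0, ?_⟩
    rw [integral_eq_lintegral_of_nonneg_ae (.of_forall (h0 τ hτ0))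
      (u τ).continuous.aestronglyMeasurable]
    exact ENNReal.toReal_mono hK (hmass τ ⟨hτ0, hτ.2⟩)
  rw [integrable_prod_iff' hmeas]
  constructor
  · rw [ae_restrict_iff' measurableSet_Ioc]
    exact .of_forall fun τ hτ => (integrable_mul_flux hJ hμ (h0 τ (hs.trans hτ.1.le))
      (hM τ (hs.trans hτ.1.le)) (hb τ hτ).1 hα hβ).1
  · refine Integrable.of_bound (C := (α + 2 * β * M) * (5 / 4) * (2 * K.toReal))
      hmeas.norm.prod_swap.integral_prod_right' ?_
    rw [ae_restrict_iff' measurableSet_Ioc]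
    refine .of_forall fun τ hτ => ?_
    rw [Real.norm_of_nonneg (integral_nonneg fun x => norm_nonneg _)]
    refine (integrable_mul_flux hJ hμ (h0 τ (hs.trans hτ.1.le))
      (hM τ (hs.trans hτ.1.le)) (hb τ hτ).1 hα hβ).2.trans ?_
    have := (hb τ hτ).2
    gcongr

/-- Entropies `∫ (α u + β u²)` decrease at least at the rate given by the energy. -/
lemma IsFlow.entropy_le {J μ : RN N → ℝ} (hJ : IsKernel J)
    (hμ : AEStronglyMeasurable μ volume) {m : ℝ} (hμ0 : ∀ᵐ x, 0 ≤ μ x) (hμm : ∀ᵐ x, μ x ≤ m)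
    {u : ℝ → RN N →ᵇ ℝ} (hu : IsFlow J μ u)
    {M α β e k : ℝ} (h0 : ∀ t, 0 ≤ t → ∀ x, 0 ≤ u t x)
    (hM : ∀ t, 0 ≤ t → ∀ x, u t x ≤ M) (hi : Integrable (u 0)) (hα : 0 ≤ α) (hβ : 0 ≤ β)
    (he0 : 0 ≤ e) (he : α * m / 2 + e ≤ β * (1 - M * m)) {s t : ℝ} (hs : 0 ≤ s) (hst : s ≤ t)
    (hk : ∀ τ ∈ Ioc s t, k ≤ energy J (u τ)) :
    ∫ x, (α * u t x + β * u t x ^ 2) ≤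
      (∫ x, (α * u s x + β * u s x ^ 2)) - e * k * (t - s) := by
  have hintg := hu.integrable_entropy_production hJ hμ h0 hM hi hα hβ hs t
  have hit : ∀ τ, 0 ≤ τ → Integrable (u τ) := fun τ hτ => hu.integrable hJ h0 hM hi hτ
  have hent : ∀ τ, 0 ≤ τ → Integrable fun x => α * u τ x + β * u τ x ^ 2 := fun τ hτ =>
    integrable_entropy (u τ).continuous (h0 τ hτ) (hM τ hτ) (hit τ hτ) α β
  have h1 : ∀ᵐ x, (α * u t x + β * u t x ^ 2) - (α * u s x + β * u s x ^ 2) =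
      ∫ τ in Ioc s t, (α + 2 * β * u τ x) * flux J (u τ) (μ x) x := by
    filter_upwards [hu.hasDerivAt] with x hx
    have hux := hu.continuous_apply x
    have hF : Continuous fun τ : ℝ => flux J (u τ) (μ x) x :=
      (hJ.continuous_flux hu.continuous).comp (by fun_prop : Continuous fun τ : ℝ => (τ, μ x, x))
    rw [← intervalIntegral.integral_of_le hst]
    refine (intervalIntegral.integral_eq_sub_of_hasDerivAt_of_le hst
      (f := fun τ => α * u τ x + β * u τ x ^ 2) (by fun_prop) (fun τ hτ => ?_)
      (Continuous.intervalIntegrable (by fun_prop) s t)).symm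
    have hd := hx τ (hs.trans_lt hτ.1)
    exact ((hd.const_mul α).add ((hd.pow 2).const_mul β)).congr_deriv (by
      norm_num
      ring)
  have h2 : (∫ x, (α * u t x + β * u t x ^ 2)) - ∫ x, (α * u s x + β * u s x ^ 2) =
      ∫ τ in Ioc s t, ∫ x, (α + 2 * β * u τ x) * flux J (u τ) (μ x) x := by
    rw [← integral_sub (hent t (hs.trans hst)) (hent s hs), integral_congr_ae h1]
    exact integral_integral_swap hintg
  -- A constant lower bound k on the energy suffices for the decay argument, so the energy itself is
  -- never integrated in time.
  have h3 : ∫ τ in Ioc s t, ∫ x, (α + 2 * β * u τ x) * flux J (u τ) (μ x) x ≤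
      ∫ τ in Ioc s t, -(e * k) := by
    refine setIntegral_mono_on hintg.integral_prod_right
      (integrableOn_const (by simp)) measurableSet_Ioc fun τ hτ => ?_
    have hτ0 : 0 ≤ τ := hs.trans hτ.1.le
    refine (integral_mul_flux_le hJ hμ hμ0 hμm (h0 τ hτ0) (hM τ hτ0) (hit τ hτ0) hα hβ he0
      he).trans (neg_le_neg ?_)
    exact mul_le_mul_of_nonneg_left (hk τ hτ) he0
  rw [setIntegral_const, smul_eq_mul, Real.volume_real_Ioc_of_le hst] at h3
  linarith

/-- The mass of a small nonnegative solution stays bounded for all times. -/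
lemma IsFlow.mass_le {J μ : RN N → ℝ} (hJ : IsKernel J)
    (hμ : AEStronglyMeasurable μ volume) {m : ℝ} (hμ0 : ∀ᵐ x, 0 ≤ μ x) (hμm : ∀ᵐ x, μ x ≤ m)
    {u : ℝ → RN N →ᵇ ℝ} (hu : IsFlow J μ u)
    {M : ℝ} (h0 : ∀ t, 0 ≤ t → ∀ x, 0 ≤ u t x)
    (hM : ∀ t, 0 ≤ t → ∀ x, u t x ≤ M) (hi : Integrable (u 0)) (hm : 0 ≤ m) (hMm : M * m < 1)
    {t : ℝ} (ht : 0 ≤ t) :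
    ∫ x, u t x ≤ (1 + m / (2 * (1 - M * m)) * M) * ∫ x, u 0 x := by
  have ha : 0 < 1 - M * m := by linarith
  -- The value for which u + b u² dissipates with e = 0: the error m/2 from the linear part equals
  -- b(1 - Mm). At time 0, b u² ≤ bM u.
  set b : ℝ := m / (2 * (1 - M * m)) with hb
  have hb0 : 0 ≤ b := by positivity
  have hb1 : b * (1 - M * m) = m / 2 := by
    rw [hb]
    generalize 1 - M * m = d at ha
    field_simp
  have h1 := hu.entropy_le hJ hμ hμ0 hμm h0 hM hi (α := 1) (β := b) (e := 0) (k := 0)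
    zero_le_one hb0 le_rfl (by linarith) le_rfl ht
    (fun τ _ => energy_nonneg hJ _)
  simp only [one_mul, zero_mul, sub_zero] at h1
  have hit := hu.integrable hJ h0 hM hi ht
  calc ∫ x, u t x ≤ ∫ x, (u t x + b * u t x ^ 2) := by
        refine integral_mono hit ?_ fun x => le_add_of_nonneg_right (by positivity)
        simpa using integrable_entropy (u t).continuous (h0 t ht) (hM t ht) hit 1 b
    _ ≤ ∫ x, (u 0 x + b * u 0 x ^ 2) := h1
    _ ≤ ∫ x, (1 + b * M) * u 0 x := by
        refine integral_mono ?_ (hi.const_mul _) fun x => ?_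
        · simpa using integrable_entropy (u 0).continuous (h0 0 le_rfl) (hM 0 le_rfl) hi 1 b
        · have := mul_le_mul_of_nonneg_left (mul_le_mul_of_nonneg_right (hM 0 le_rfl x)
            (h0 0 le_rfl x)) hb0
          simp only
          linarith
    _ = _ := integral_const_mul _ _

/-! ### Algebraic decay from dissipation and the Nash inequality. -/

/-- The time scale on which the dissipation dominates. -/
noncomputable def diffusivity (N : ℕ) (a C : ℝ) : ℝ := a / (C * 2 ^ (N + 1))

/-- The constant in the algebraic decay estimate. -/
noncomputable def decayConst (N : ℕ) (a C : ℝ) : ℝ :=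
  2 ^ (N + 1) * (2 ^ (N + 1) / diffusivity N a C ^ ((N : ℝ) / 2))

lemma diffusivity_pos (N : ℕ) {a C : ℝ} (ha : 0 < a) (hC : 0 < C) : 0 < diffusivity N a C := by
  unfold diffusivity
  positivity

lemma decayConst_pos (N : ℕ) {a C : ℝ} (ha : 0 < a) (hC : 0 < C) : 0 < decayConst N a C := by
  have := diffusivity_pos N ha hC
  unfold decayConst
  positivity

lemma two_rpow_half_le (N : ℕ) : (2 : ℝ) ^ ((N : ℝ) / 2) ≤ 2 ^ N := by
  rw [← Real.rpow_natCast]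
  exact Real.rpow_le_rpow_of_exponent_le one_le_two (half_le_self (by positivity))

lemma sqrt_pow_eq_rpow {x : ℝ} (hx : 0 ≤ x) (N : ℕ) : √x ^ N = x ^ ((N : ℝ) / 2) := by
  rw [Real.sqrt_eq_rpow, ← Real.rpow_natCast, ← Real.rpow_mul hx]
  congr 1
  ring

/-- Doubling the time halves the rescaled quantity, up to a constant. -/
lemma rescaled_two_mul_le {y E : ℝ → ℝ} {a C A : ℝ} (ha : 0 < a) (hC : 0 < C)
    (hy : ∀ t, 0 ≤ t → 0 ≤ y t) (hE : ∀ t, 0 ≤ t → 0 ≤ E t)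
    (hdiss : ∀ s t k, 0 ≤ s → s ≤ t → (∀ τ ∈ Ioc s t, k ≤ E τ) → y t ≤ y s - a * k * (t - s))
    (hnash : ∀ t r, 0 ≤ t → 1 ≤ r → y t ≤ A / r ^ N + C * r ^ 2 * E t)
    {T : ℝ} (hT0 : 0 < T) (hT : 1 ≤ diffusivity N a C * T) :
    (2 * T) ^ ((N : ℝ) / 2) * y (2 * T) ≤
      (T ^ ((N : ℝ) / 2) * y T + 2 ^ (N + 1) * A / diffusivity N a C ^ ((N : ℝ) / 2)) / 2 := by
  set κ := diffusivity N a C with hκ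
  have hκ0 : 0 < κ := diffusivity_pos N ha hC
  have hanti : ∀ s t, 0 ≤ s → s ≤ t → y t ≤ y s := fun s t hs hst => by
    simpa using hdiss s t 0 hs hst fun τ hτ => hE τ (hs.trans hτ.1.le)
  set r := √(κ * T) with hr
  have hr1 : 1 ≤ r := Real.one_le_sqrt.2 hT
  have hr2 : r ^ 2 = κ * T := Real.sq_sqrt (by positivity)
  have hrN : r ^ N = (κ * T) ^ ((N : ℝ) / 2) := sqrt_pow_eq_rpow (by positivity) N
  have hr0 : 0 < r := by linarith
  -- As y is nonincreasing, Nash at scale r bounds the energy below on all of (T, 2T] in terms of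
  -- y(2T).
  have h1 := hdiss T (2 * T) ((y (2 * T) - A / r ^ N) / (C * r ^ 2)) hT0.le (by linarith)
    fun τ hτ => by
      rw [div_le_iff₀' (by positivity)]
      have h2 := hnash τ r (hT0.le.trans hτ.1.le) hr1
      have h3 := hanti τ (2 * T) (hT0.le.trans hτ.1.le) hτ.2
      linarith
  -- The choice r² = κT makes the dissipation coefficient exactly 2^(N + 1): it beats the factor
  -- (2T)^(N/2)/T^(N/2) ≤ 2^N and still leaves 1/2.
  have h4 : a * ((y (2 * T) - A / r ^ N) / (C * r ^ 2)) * (2 * T - T) =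
      2 ^ (N + 1) * (y (2 * T) - A / r ^ N) := by
    rw [hr2, hκ, diffusivity]
    field_simp
    ring
  rw [h4] at h1
  have hpow : (0:ℝ) < 2 ^ N := by positivity
  have hTN : 0 < T ^ ((N : ℝ) / 2) := by positivity
  have hκN : 0 < κ ^ ((N : ℝ) / 2) := by positivity
  have h5 : T ^ ((N : ℝ) / 2) * (A / r ^ N) = A / κ ^ ((N : ℝ) / 2) := by
    rw [hrN, Real.mul_rpow hκ0.le hT0.le]
    field_simp
  have hy2 := hy (2 * T) (by positivity)
  have h6 : 2 ^ (N + 1) * (T ^ ((N : ℝ) / 2) * y (2 * T)) ≤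
      T ^ ((N : ℝ) / 2) * y T + 2 ^ (N + 1) * (A / κ ^ ((N : ℝ) / 2)) := by
    rw [← h5]
    have := mul_le_mul_of_nonneg_left h1 hTN.le
    nlinarith [mul_nonneg hTN.le hy2]
  calc (2 * T) ^ ((N : ℝ) / 2) * y (2 * T)
      = 2 ^ ((N : ℝ) / 2) * (T ^ ((N : ℝ) / 2) * y (2 * T)) := by
        rw [Real.mul_rpow zero_le_two hT0.le]
        ring
    _ ≤ 2 ^ N * (T ^ ((N : ℝ) / 2) * y (2 * T)) := by
        gcongr
        exact two_rpow_half_le N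
    _ ≤ _ := by
        rw [pow_succ] at h6 ⊢
        rw [mul_div_assoc]
        linarith

/-- A dissipation inequality together with a Nash inequality yields algebraic decay. -/
lemma eventually_decay {y E : ℝ → ℝ} {a C A : ℝ} (ha : 0 < a) (hC : 0 < C) (hA : 0 < A)
    (hy : ∀ t, 0 ≤ t → 0 ≤ y t) (hE : ∀ t, 0 ≤ t → 0 ≤ E t)
    (hdiss : ∀ s t k, 0 ≤ s → s ≤ t → (∀ τ ∈ Ioc s t, k ≤ E τ) → y t ≤ y s - a * k * (t - s))
    (hnash : ∀ t r, 0 ≤ t → 1 ≤ r → y t ≤ A / r ^ N + C * r ^ 2 * E t) :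
    ∀ᶠ t in atTop, y t ≤ decayConst N a C * A * t ^ (-(N : ℝ) / 2) := by
  set κ := diffusivity N a C with hκ
  have hκ0 : 0 < κ := diffusivity_pos N ha hC
  set D := 2 ^ (N + 1) * A / κ ^ ((N : ℝ) / 2) with hD
  have hD0 : 0 < D := by positivity
  -- The first time at which the scale r = √(κT) reaches 1.
  set T₀ := 1 / κ with hT₀
  have hT₀0 : 0 < T₀ := by positivity
  set z : ℝ → ℝ := fun t => t ^ ((N : ℝ) / 2) * y t with hz
  have hdy : ∀ k : ℕ, z (2 ^ k * T₀) ≤ z T₀ / 2 ^ k + D := by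
    intro k
    induction k with
    | zero => simpa using hD0.le
    | succ k ih =>
      have hk1 : (1:ℝ) ≤ 2 ^ k := one_le_pow₀ one_le_two
      have h1 : 1 ≤ κ * (2 ^ k * T₀) := by
        have : κ * (2 ^ k * T₀) = 2 ^ k := by rw [hT₀]; field_simp
        rwa [this]
      have h2 := rescaled_two_mul_le (N := N) ha hC hy hE hdiss hnash
        (by positivity : 0 < 2 ^ k * T₀) h1
      have h3 : (2:ℝ) ^ (k + 1) * T₀ = 2 * (2 ^ k * T₀) := by ring
      rw [h3]
      have h4 : z T₀ / 2 ^ (k + 1) = z T₀ / 2 ^ k / 2 := by rw [pow_succ]; field_simp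
      rw [h4]
      simp only [hz] at ih ⊢
      linarith
  -- The second threshold makes z(T₀)/2^k ≤ D, so the constant does not involve the value at T₀.
  -- Between dyadic times monotonicity of y is used.
  filter_upwards [eventually_ge_atTop T₀, eventually_ge_atTop (2 * T₀ * z T₀ / D)] with t ht htz
  have ht0 : 0 < t := hT₀0.trans_le ht
  obtain ⟨k, hk1, hk2⟩ := exists_nat_pow_near ((one_le_div hT₀0).2 ht) one_lt_two
  rw [le_div_iff₀ hT₀0] at hk1
  rw [div_lt_iff₀ hT₀0] at hk2
  have hpk : (0:ℝ) < 2 ^ k := by positivity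
  have hz0 : 0 ≤ z T₀ := mul_nonneg (by positivity) (hy _ hT₀0.le)
  have hzk : z T₀ / 2 ^ k ≤ D := by
    rw [div_le_iff₀ hpk]
    rw [div_le_iff₀ hD0] at htz
    have h5 : t * D ≤ 2 ^ (k + 1) * T₀ * D := by gcongr
    rw [pow_succ] at h5
    have h6 : 2 * T₀ * z T₀ ≤ 2 * T₀ * (D * 2 ^ k) := by linarith
    exact le_of_mul_le_mul_left h6 (by positivity)
  have hyt : y t ≤ y (2 ^ k * T₀) := by
    simpa using hdiss (2 ^ k * T₀) t 0 (by positivity) hk1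
      fun τ hτ => hE τ ((by positivity : 0 ≤ 2 ^ k * T₀).trans hτ.1.le)
  have h7 : t ^ ((N : ℝ) / 2) * y t ≤ 2 ^ (N + 1) * D := by
    have hy1 := hy t ht0.le
    calc t ^ ((N : ℝ) / 2) * y t ≤ (2 * (2 ^ k * T₀)) ^ ((N : ℝ) / 2) * y (2 ^ k * T₀) := by
          gcongr
          rw [pow_succ] at hk2
          linarith
      _ = 2 ^ ((N : ℝ) / 2) * z (2 ^ k * T₀) := by
          rw [Real.mul_rpow zero_le_two (by positivity)]
          simp only [hz]
          ring
      _ ≤ 2 ^ N * (D + D) := by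
          have := hy (2 ^ k * T₀) (by positivity)
          have h8 : z (2 ^ k * T₀) ≤ D + D := (hdy k).trans (by linarith)
          have h9 : 0 ≤ z (2 ^ k * T₀) := by
            simp only [hz]
            positivity
          gcongr
          exact two_rpow_half_le N
      _ = _ := by ring
  rw [neg_div, Real.rpow_neg ht0.le, ← div_eq_mul_inv, le_div_iff₀' (by positivity)]
  refine h7.trans (le_of_eq ?_)
  rw [hD, decayConst]
  ring

/-! ### Norms and assembly of the theorem. -/

lemma le_lpNorm_top_of_continuous {v : RN N → ℝ} (hc : Continuous v) (hv : MemLp v ∞ volume)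
    (x : RN N) : v x ≤ lpNorm v ∞ volume := by
  have hcl : IsClosed {x | ‖v x‖ ≤ lpNorm v ∞ volume} :=
    isClosed_le hc.norm continuous_const
  have h1 : ‖v x‖ ≤ lpNorm v ∞ volume :=
    hcl.closure_subset (Measure.dense_of_ae (ae_le_lpNorm_exponent_top hv) x)
  exact (le_abs_self _).trans h1

lemma lpNorm_two_sq {v : RN N → ℝ} (hc : Continuous v) :
    lpNorm v 2 volume ^ 2 = ∫ x, v x ^ 2 := by
  rw [lpNorm_eq_integral_norm_rpow_toReal two_ne_zero ENNReal.ofNat_ne_top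
    hc.aestronglyMeasurable]
  have h1 : ∀ x, ‖v x‖ ^ (2 : ℝ≥0∞).toReal = v x ^ 2 := fun x => by
    simp
  simp_rw [h1]
  have h2 : 0 ≤ ∫ x, v x ^ 2 := integral_nonneg fun x => sq_nonneg _
  rw [← Real.rpow_natCast, ← Real.rpow_mul h2]
  simp

/-- The bound for the growth of the mass. -/
noncomputable def massConst (m M : ℝ) : ℝ := 1 + |m / (2 * (1 - M * m)) * M|

/-- Decay of the `L²` norm for bounded nonnegative flows with integrable initial datum. -/
lemma IsFlow.eventually_sq_le {J μ : RN N → ℝ} (hJ : IsKernel J)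
    (hμ : AEStronglyMeasurable μ volume) {m : ℝ} (hμ0 : ∀ᵐ x, 0 ≤ μ x) (hμm : ∀ᵐ x, μ x ≤ m)
    {u : ℝ → RN N →ᵇ ℝ} (hu : IsFlow J μ u) {M : ℝ} (h0 : ∀ t, 0 ≤ t → ∀ x, 0 ≤ u t x)
    (hM : ∀ t, 0 ≤ t → ∀ x, u t x ≤ M) (hi : Integrable (u 0)) (hm : 0 ≤ m) (hMm : M * m < 1)
    {C : ℝ} (hC : 0 < C)
    (hnash : ∀ v : RN N → ℝ, Continuous v → (∀ x, 0 ≤ v x) → Integrable v → MemLp v 2 →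
      ∀ r : ℝ, 1 ≤ r →
        ∫ x, v x ^ 2 ≤ C * (∫ x, v x) ^ 2 / r ^ N + C * r ^ 2 * energy J v) :
    ∀ᶠ t in atTop, ∫ x, u t x ^ 2 ≤ decayConst N (1 - M * m) C *
      (C * (massConst m M * ∫ x, u 0 x) ^ 2) * t ^ (-(N : ℝ) / 2) := by
  have ha : 0 < 1 - M * m := by linarith
  have hM0 : 0 ≤ M := (h0 0 le_rfl 0).trans (hM 0 le_rfl 0)
  have hit : ∀ t, 0 ≤ t → Integrable (u t) := fun t ht => hu.integrable hJ h0 hM hi ht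
  have hnn : ∀ t, 0 ≤ t → 0 ≤ ∫ x, u t x := fun t ht => integral_nonneg (h0 t ht)
  have hK : massConst m M = 1 + m / (2 * (1 - M * m)) * M := by
    rw [massConst, abs_of_nonneg (by positivity)]
  have hK0 : 0 < massConst m M := by unfold massConst; positivity
  have hmass : ∀ t, 0 ≤ t → ∫ x, u t x ≤ massConst m M * ∫ x, u 0 x := fun t ht => by
    rw [hK]
    exact hu.mass_le hJ hμ hμ0 hμm h0 hM hi hm hMm ht
  have h2 : ∀ t, 0 ≤ t → MemLp (u t) 2 := fun t ht =>
    memLp_two_of_bounded (u t).continuous (h0 t ht) (hM t ht) (hit t ht)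
  -- `eventually_decay` needs a positive mass constant A; with zero initial mass the solution has
  -- zero mass, hence zero L² norm, for all later times.
  rcases (hnn 0 le_rfl).eq_or_lt with hzero | hpos
  · filter_upwards [eventually_ge_atTop 0] with t ht
    have h3 : ∫ x, u t x = 0 := le_antisymm (by simpa [← hzero] using hmass t ht) (hnn t ht)
    have h4 : ∫ x, u t x ^ 2 ≤ ∫ x, M * u t x :=
      integral_mono (h2 t ht).integrable_sq ((hit t ht).const_mul M) fun x => by
        simp only
        rw [sq]
        exact mul_le_mul_of_nonneg_right (hM t ht x) (h0 t ht x)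
    rw [integral_const_mul, h3, mul_zero] at h4
    simpa [← hzero] using h4
  · refine eventually_decay (E := fun t => energy J (u t)) ha hC (by positivity)
      (fun t _ => integral_nonneg fun x => sq_nonneg _) (fun t _ => energy_nonneg hJ _) ?_ ?_
    · intro s t k hs hst hk
      simpa using hu.entropy_le hJ hμ hμ0 hμm h0 hM hi (α := 0) (β := 1) (e := 1 - M * m)
        le_rfl zero_le_one ha.le (by linarith) hs hst hk
    · intro t r ht hr
      refine (hnash (u t) (u t).continuous (h0 t ht) (hit t ht) (h2 t ht) r hr).trans ?_
      have h5 := hnn t ht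
      have h6 := hmass t ht
      have hr0 : 0 < r := by linarith
      gcongr

end NonlocalKPZ


open NonlocalKPZ in
theorem theorem2p12 (N : ℕ) (hN : 1 ≤ N) (J : NonlocalKPZ.RN N → ℝ)
    (hJ : NonlocalKPZ.IsKernel J) :
    -- `C ‖μ‖_∞ ‖u₀‖_∞` is the constant; it depends on nothing else, besides `N` and `J`
    ∃ C : ℝ → ℝ → ℝ, (∀ m M : ℝ, 0 < C m M) ∧
      ∀ μ : NonlocalKPZ.RN N → ℝ, MemLp μ ∞ volume → (∀ᵐ x, 0 ≤ μ x) →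
      ∀ u₀ : NonlocalKPZ.RN N → ℝ, Continuous u₀ → MemLp u₀ 1 volume → MemLp u₀ ∞ volume →
        (∀ x, 0 ≤ u₀ x) →
        lpNorm u₀ ∞ volume * lpNorm μ ∞ volume < 1 →
      ∀ u : ℝ → BoundedContinuousFunction (NonlocalKPZ.RN N) ℝ,
        NonlocalKPZ.IsCauchySolution J (NonlocalKPZ.gMu μ) u₀ u →
        ∀ᶠ t : ℝ in atTop,
          MemLp (u t) 2 volume ∧
          lpNorm (u t) 2 volume ^ 2 ≤
            C (lpNorm μ ∞ volume) (lpNorm u₀ ∞ volume) *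
              lpNorm u₀ 1 volume ^ 2 * t ^ (-(N : ℝ) / 2) := by
  obtain ⟨c, hc, hnash⟩ := hJ.exists_nash
  -- The value 1 outside the smallness regime only serves positivity for all arguments.
  refine ⟨fun m M => if M * m < 1 then decayConst N (1 - M * m) c * (c * massConst m M ^ 2) else 1,
    fun m M => ?_, ?_⟩
  · dsimp only
    split_ifs with h
    · have h1 := decayConst_pos N (sub_pos.2 h) hc
      have h2 : 0 < massConst m M := by unfold massConst; positivity
      positivity
    · exact one_pos
  · intro μ hμ hμ0 u₀ hu₀c hu₀1 hu₀i hu₀0 hsmall u hu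
    have hflow := hu.isFlow hJ
    have hU0 : ∀ x, u (max 0 0) x = u₀ x := fun x => by rw [max_self]; exact hu.initial x
    have h0 : ∀ t, 0 ≤ t → ∀ x, 0 ≤ u (max t 0) x := fun t ht x =>
      hflow.lower_bound hJ (fun x => by rw [hU0]; exact hu₀0 x) ht x
    have hM : ∀ t, 0 ≤ t → ∀ x, u (max t 0) x ≤ lpNorm u₀ ∞ volume := fun t ht x =>
      hflow.upper_bound hJ
        (fun x => by rw [hU0]; exact le_lpNorm_top_of_continuous hu₀c hu₀i x) ht x
    have hμm : ∀ᵐ x, μ x ≤ lpNorm μ ∞ volume := by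
      filter_upwards [ae_le_lpNorm_exponent_top hμ] with x hx using (le_abs_self _).trans hx
    have hcoe : ⇑(u (max 0 0)) = u₀ := funext hU0
    have hi : Integrable (u (max 0 0)) := by
      rw [hcoe]
      exact memLp_one_iff_integrable.1 hu₀1
    have hmass : ∫ x, u (max 0 0) x = lpNorm u₀ 1 volume := by
      rw [hcoe, lpNorm_one_eq_integral_norm hu₀1.aestronglyMeasurable]
      simp_rw [Real.norm_of_nonneg (hu₀0 _)]
    filter_upwards [eventually_ge_atTop 0, hflow.eventually_sq_le hJ hμ.aestronglyMeasurable hμ0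
      hμm h0 hM hi lpNorm_nonneg hsmall hc hnash] with t ht hdecay
    have hintg := hflow.integrable hJ h0 hM hi ht
    have h0t := h0 t ht
    have hMt := hM t ht
    rw [max_eq_left ht] at hintg h0t hMt hdecay
    refine ⟨memLp_two_of_bounded (u t).continuous h0t hMt hintg, ?_⟩
    rw [lpNorm_two_sq (u t).continuous, if_pos hsmall]
    refine hdecay.trans (le_of_eq ?_)
    rw [hmass]
    ring
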